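/- Let $(n_m)_{m\ge1}$ be positive integers with $n_{m+1}\ge 4n_m$, let $I_m=[\tfrac12 n_m,\tfrac32 n_m]$, and let $(t_k)_{k\ge1}$ be a strictly decreasing sequence of positive reals with $t_k\to0$, such that for every $s\in\mathbb R$ there is at most one $k$ with $t_ks\in\bigcup_m I_m$ (call such a pair of sequences separated). Then the measures $\prod_{m=1}^{k}(1+\cos(2\pi n_mx))\,dx$ on $[0,1]$ converge weakly, as $k\to\infty$, to a measure $\mu$ on $[0,1]$ (the Riesz product). Let $\nu$ be the measure on $\mathbb R$ obtained by extending $\mu$ to $\mathbb R$ with period $1$, that is, taking $\sum_{j\in\mathbb Z}\mu(\cdot-j)$, multiplying by the function $(1-\cos 2\pi t)/t^2$ (with value $2\pi^2$ at $t=0$), and dividing by the total mass; $\nu$ is a probability measure. For $t>0$ let $C_t\nu(A)=\nu(A/t)$ be its contraction, and let $C_t\nu*f(x)=\int f(x-y)\,dC_t\nu(y)$; for $f\in L^2(\mathbb R)$ this integral converges absolutely for a.e. $x$, for all $t=t_k$. Then: 1. There is a constant $C$ (depending only on the two sequences) such that $\big\|\sup_{k\ge1}|C_{t_k}\nu*f|\big\|_2\le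 C\|f\|_2$ for all $f\in L^2(\mathbb R)$. 2. For all $f\in L^2(\mathbb R)$, $C_{t_k}\nu*f\to f$ almost everywhere as $k\to\infty$. Separated pairs exist: for example, $n_m=2^{2^{2m}}$ and $t_k=2^{-2^{2k+1}}$ $(m,k\ge1)$ is one. -/

import Mathlib

open MeasureTheory Filter Topology
open scoped ENNReal NNReal

noncomputable section

/-- The partial products `p_k(x) = ∏_{m < k} (1 + cos (2π n_m x))` of the Riesz product. -/
def rieszPartial (n : ℕ → ℕ) (k : ℕ) (x : ℝ) : ℝ :=
  ∏ m ∈ Finset.range k, (1 + Real.cos (2 * Real.pi * (n m : ℝ) * x))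

theorem rieszPartial_le (n : ℕ → ℕ) (k : ℕ) (x : ℝ) : rieszPartial n k x ≤ 2 ^ k := by
  unfold rieszPartial
  calc _ ≤ ∏ _m ∈ Finset.range k, (2 : ℝ) := by
        refine Finset.prod_le_prod (fun m _ => ?_) (fun m _ => ?_)
        · linarith [Real.neg_one_le_cos (2 * Real.pi * (n m : ℝ) * x)]
        · linarith [Real.cos_le_one (2 * Real.pi * (n m : ℝ) * x)]
    _ = 2 ^ k := by simp

/-- The absolutely continuous measure `p_k(x) dx` on `[0,1]`, as a finite measure on `ℝ`. -/
def rieszPartialMeasure (n : ℕ → ℕ) (k : ℕ) : FiniteMeasure ℝ :=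
  ⟨(volume.restrict (Set.Icc (0 : ℝ) 1)).withDensity
      (fun x => ENNReal.ofReal (rieszPartial n k x)), by
    refine isFiniteMeasure_withDensity (ne_of_lt ?_)
    calc ∫⁻ x, ENNReal.ofReal (rieszPartial n k x) ∂(volume.restrict (Set.Icc (0 : ℝ) 1))
        ≤ ∫⁻ _x, ENNReal.ofReal (2 ^ k) ∂(volume.restrict (Set.Icc (0 : ℝ) 1)) :=
          lintegral_mono (fun x => ENNReal.ofReal_le_ofReal (rieszPartial_le n k x))
      _ < ∞ := by simp⟩

/-- The Riesz product measure `∏_m (1 + cos (2π n_m x))` on `[0,1]`: the weak limit of the measures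
`p_k(x) dx` (the topology on `FiniteMeasure ℝ` is that of weak convergence). -/
def rieszMeasure (n : ℕ → ℕ) : FiniteMeasure ℝ :=
  limUnder atTop (rieszPartialMeasure n)

/-- The `1`-periodic extension to `ℝ` of a measure carried by `[0,1]`. -/
def periodize (μ : Measure ℝ) : Measure ℝ :=
  Measure.sum (fun j : ℤ => μ.map (fun x => x + (j : ℝ)))

/-- The function `(1 - cos (2πt)) / t²`, extended continuously to `t = 0`. -/
def fejerDensity (t : ℝ) : ℝ :=
  if t = 0 then 2 * Real.pi ^ 2 else (1 - Real.cos (2 * Real.pi * t)) / t ^ 2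

/-- Normalization of a measure to total mass `1`. -/
def normalizeMeasure (μ : Measure ℝ) : Measure ℝ := (μ Set.univ)⁻¹ • μ

/-- The measure `ν`: the periodized Riesz product, multiplied by `(1 - cos (2πt)) / t²`
and normalized. -/
def nuMeasure (n : ℕ → ℕ) : Measure ℝ :=
  normalizeMeasure ((periodize (rieszMeasure n : Measure ℝ)).withDensity
    (fun t => ENNReal.ofReal (fejerDensity t)))

/-- The contraction `C_t μ`, the image of `μ` under `x ↦ t x`. -/
def contraction (t : ℝ) (μ : Measure ℝ) : Measure ℝ := μ.map (fun x => t * x)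

/-- The convolution `(μ ∗ f)(x) = ∫ f(x - y) dμ(y)`. -/
def measConv (μ : Measure ℝ) (f : ℝ → ℂ) (x : ℝ) : ℂ := ∫ y, f (x - y) ∂μ

/-- The interval `[n_m / 2, 3 n_m / 2]` containing the `m`-th cloud of frequencies. -/
def cloud (n : ℕ → ℕ) (m : ℕ) : Set ℝ := Set.Icc ((n m : ℝ) / 2) (3 * (n m : ℝ) / 2)

/-- The requirements on the frequencies `n_m` and on the contraction factors `t_k`
(both indexed from `0`): the `n_m` are positive integers with ratios at least `4`, the `t_k`
decrease to `0`, and for every `s` there is at most one `k` such that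
`t_k s` lies in some cloud interval (equivalently, the dilated intervals `t_k⁻¹ C_m` and
`t_l⁻¹ C_{m'}` are disjoint whenever `k ≠ l`). -/
structure SeparatedClouds (n : ℕ → ℕ) (t : ℕ → ℝ) : Prop where
  freq_pos : ∀ m, 0 < n m
  growth : ∀ m, 4 * n m ≤ n (m + 1)
  pos : ∀ k, 0 < t k
  anti : StrictAnti t
  tendsto_zero : Tendsto t atTop (𝓝 0)
  separated : ∀ (s : ℝ) (k l m m' : ℕ), t k * s ∈ cloud n m → t l * s ∈ cloud n m' → k = l

end

/-!
Write `φ` for the function `fejerDensity` and `p_k` for the partial Riesz products. The Fourier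
transform of `φ` is `2π²` times the triangle function, so it is supported in `[-1, 1]`. Since
`p_{k+1} - p_k = p_k cos(2π n_k x)`, and `p_k` is a trigonometric polynomial of degree at most
`n_0 + … + n_{k-1} < n_k / 3`, the Fourier transforms of `φ p_k` and `φ p_{k+1}` differ only within
`n_k / 2` of `± n_k`, if `k ≥ 1`. The Fourier transform of `ν` is the limit of those of `φ p_k / c`
(`tendsto_rieszFourier_fejerMeasure`), whence it agrees outside of the clouds with that of the
absolutely continuous measure `φ p_1 dx / c`, called `nuLow` (`fourierMeas_nuMeasure_eq`).

As the clouds are separated, for every frequency `ξ` at most one of the differences of the Fourier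
transforms of `C_{t_k} ν` and `C_{t_k} nuLow` is nonzero at `ξ`. By Plancherel's theorem the square
function `(∑ |C_{t_k} ν ∗ f - C_{t_k} nuLow ∗ f|²)^{1/2}` is therefore bounded on `L²`
(`sum_eLpNorm_sq_measConv_sub_le`). It dominates the supremum of the differences, and what remains
is the maximal function of the dilates of `nuLow`, whose density is at most a multiple of the
Poisson kernel `1 / (1 + x²)`.

The `L²` maximal inequality for Poisson integrals is proved by the `TT*` method: up to a constant,
the product of two Poisson operators is at most the one with the larger parameter
(`lintegral_poissonKer_mul_le`), so the best constant `K` in the inequality for finitely many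
kernels satisfies `K² ≤ c² K` with `c` independent of their number (`lintegral_sq_poissonMax_le`).

Almost everywhere convergence follows from the maximal inequality, since convergence holds
everywhere for continuous functions of compact support. The weak convergence of the Riesz product
itself comes from the eventual constancy of its Fourier coefficients, the density of trigonometric
polynomials, and Prokhorov's theorem.
-/

open MeasureTheory Filter Topology
open scoped ENNReal NNReal

/-! ### Convolution with finite measures on `L²` -/

theorem lintegral_mul_sq_le {α : Type*} [MeasurableSpace α] (η : Measure α) {f g : α → ℝ≥0∞}
    (hf : AEMeasurable f η) (hg : AEMeasurable g η) :
    (∫⁻ y, f y * g y ∂η) ^ 2 ≤ (∫⁻ y, f y ^ 2 ∂η) * ∫⁻ y, g y ^ 2 ∂η := by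
  have h := ENNReal.lintegral_mul_le_Lp_mul_Lq η Real.HolderConjugate.two_two hf hg
  calc _ ≤ _ := pow_le_pow_left' h 2
    _ = _ := by
      rw [mul_pow, ← ENNReal.rpow_natCast, ← ENNReal.rpow_natCast, ← ENNReal.rpow_mul,
        ← ENNReal.rpow_mul]
      norm_num

theorem sq_lintegral_le {α : Type*} [MeasurableSpace α] (η : Measure α) {g : α → ℝ≥0∞}
    (hg : AEMeasurable g η) :
    (∫⁻ y, g y ∂η) ^ 2 ≤ η Set.univ * ∫⁻ y, g y ^ 2 ∂η := by
  simpa using lintegral_mul_sq_le η (aemeasurable_const (b := (1 : ℝ≥0∞))) hg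

theorem lintegral_lintegral_comp_sub (η : Measure ℝ) [SFinite η] {h : ℝ → ℝ≥0∞}
    (hh : Measurable h) :
    ∫⁻ x, ∫⁻ y, h (x - y) ∂η = η Set.univ * ∫⁻ x, h x := by
  rw [lintegral_lintegral_swap (by fun_prop)]
  simp [lintegral_sub_right_eq_self, mul_comm]

/-- Young's inequality `L² ∗ M → L²` for nonnegative functions. -/
theorem lintegral_sq_conv_le (η : Measure ℝ) [SFinite η] {h : ℝ → ℝ≥0∞} (hh : Measurable h) :
    ∫⁻ x, (∫⁻ y, h (x - y) ∂η) ^ 2 ≤ η Set.univ ^ 2 * ∫⁻ x, h x ^ 2 := by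
  calc ∫⁻ x, (∫⁻ y, h (x - y) ∂η) ^ 2
      ≤ ∫⁻ x, ∫⁻ y, η Set.univ * h (x - y) ^ 2 ∂η := by
        refine lintegral_mono fun x => ?_
        rw [lintegral_const_mul _ (by fun_prop)]
        exact sq_lintegral_le η (by fun_prop)
    _ = η Set.univ ^ 2 * ∫⁻ x, h x ^ 2 := by
        rw [lintegral_lintegral_comp_sub η (h := fun z => η Set.univ * h z ^ 2) (by fun_prop),
          lintegral_const_mul _ (by fun_prop)]
        ring

/-- Functions equal almost everywhere have, at almost every point, reflected translates which are
equal almost everywhere for any given s-finite measure. -/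
theorem ae_ae_eq_comp_sub (η : Measure ℝ) [SFinite η] {E : Type*} {f g : ℝ → E}
    (h : f =ᵐ[volume] g) :
    ∀ᵐ x, (fun y => f (x - y)) =ᵐ[η] fun y => g (x - y) := by
  obtain ⟨s, hs, hsm, hs0⟩ := exists_measurable_superset_of_null (ae_iff.1 h)
  have h1 : ∫⁻ x, ∫⁻ y, s.indicator 1 (x - y) ∂η = 0 := by
    rw [lintegral_lintegral_comp_sub η (measurable_one.indicator hsm)]
    simp [lintegral_indicator_one hsm, hs0]
  have hm : Measurable fun p : ℝ × ℝ => s.indicator (1 : ℝ → ℝ≥0∞) (p.1 - p.2) :=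
    (measurable_one.indicator hsm).comp (by fun_prop)
  rw [lintegral_eq_zero_iff hm.lintegral_prod_right'] at h1
  filter_upwards [h1] with x hx
  have hmx : Measurable fun y => s.indicator (1 : ℝ → ℝ≥0∞) (x - y) :=
    (measurable_one.indicator hsm).comp (by fun_prop)
  rw [Pi.zero_apply, lintegral_eq_zero_iff hmx] at hx
  filter_upwards [hx] with y hy
  by_contra hne
  have : x - y ∈ s := hs hne
  simp [this] at hy

theorem eLpNorm_two_sq {α E : Type*} [MeasurableSpace α] [ENorm E] (f : α → E) (η : Measure α) :
    eLpNorm f 2 η ^ 2 = ∫⁻ x, ‖f x‖ₑ ^ 2 ∂η := by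
  rw [eLpNorm_eq_lintegral_rpow_enorm_toReal (by norm_num) (by norm_num), ← ENNReal.rpow_natCast,
    ← ENNReal.rpow_mul]
  simp

theorem ae_integrable_comp_sub (η : Measure ℝ) [IsFiniteMeasure η] {f : ℝ → ℂ}
    (hf : MemLp f 2 volume) : ∀ᵐ x, Integrable (fun y => f (x - y)) η := by
  obtain ⟨g, hg, hfg⟩ := hf.1
  have hm : Measurable fun z => ‖g z‖ₑ := hg.measurable.enorm
  have h2 : ∫⁻ x, (∫⁻ y, ‖g (x - y)‖ₑ ∂η) ^ 2 ≠ ∞ := by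
    refine ne_top_of_le_ne_top ?_ (lintegral_sq_conv_le η hm)
    rw [← eLpNorm_two_sq]
    have := (hf.ae_eq hfg).2
    finiteness
  have hm2 : Measurable fun p : ℝ × ℝ => ‖g (p.1 - p.2)‖ₑ := hm.comp (by fun_prop)
  filter_upwards [ae_lt_top (hm2.lintegral_prod_right'.pow_const 2) h2, ae_ae_eq_comp_sub η hfg]
    with x hx hx2
  refine Integrable.congr ⟨(hg.comp_measurable (by fun_prop)).aestronglyMeasurable, ?_⟩ hx2.symm
  rw [hasFiniteIntegral_iff_enorm]
  by_contra hcon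
  simp only [not_lt_top_iff, Function.comp_apply] at hcon
  simp [hcon] at hx

theorem measConv_congr (η : Measure ℝ) [SFinite η] {f g : ℝ → ℂ} (h : f =ᵐ[volume] g) :
    measConv η f =ᵐ[volume] measConv η g := by
  filter_upwards [ae_ae_eq_comp_sub η h] with x hx
  exact integral_congr_ae hx

theorem aestronglyMeasurable_measConv (η : Measure ℝ) [SFinite η] {f : ℝ → ℂ}
    (hf : AEStronglyMeasurable f volume) : AEStronglyMeasurable (measConv η f) volume := by
  obtain ⟨g, hg, hfg⟩ := hf
  refine AEStronglyMeasurable.congr ?_ (measConv_congr η hfg).symm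
  have : StronglyMeasurable fun p : ℝ × ℝ => g (p.1 - p.2) := hg.comp_measurable (by fun_prop)
  exact this.integral_prod_right'.aestronglyMeasurable

theorem lintegral_sq_measConv_le (η : Measure ℝ) [IsFiniteMeasure η] {f : ℝ → ℂ}
    (hf : AEStronglyMeasurable f volume) :
    ∫⁻ x, ‖measConv η f x‖ₑ ^ 2 ≤ η Set.univ ^ 2 * ∫⁻ x, ‖f x‖ₑ ^ 2 := by
  obtain ⟨g, hg, hfg⟩ := hf
  calc _ = ∫⁻ x, ‖measConv η g x‖ₑ ^ 2 := by
        refine lintegral_congr_ae ?_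
        filter_upwards [measConv_congr η hfg] with x hx
        rw [hx]
    _ ≤ ∫⁻ x, (∫⁻ y, ‖g (x - y)‖ₑ ∂η) ^ 2 :=
        lintegral_mono fun x => pow_le_pow_left' (enorm_integral_le_lintegral_enorm _) 2
    _ ≤ η Set.univ ^ 2 * ∫⁻ x, ‖g x‖ₑ ^ 2 := lintegral_sq_conv_le η hg.measurable.enorm
    _ = _ := by
        congr 1
        refine lintegral_congr_ae ?_
        filter_upwards [hfg] with x hx
        rw [hx]

theorem eLpNorm_measConv_le (η : Measure ℝ) [IsFiniteMeasure η] {f : ℝ → ℂ}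
    (hf : AEStronglyMeasurable f volume) :
    eLpNorm (measConv η f) 2 volume ≤ η Set.univ * eLpNorm f 2 volume := by
  rw [← ENNReal.pow_le_pow_left_iff two_ne_zero, mul_pow, eLpNorm_two_sq, eLpNorm_two_sq]
  exact lintegral_sq_measConv_le η hf

theorem memLp_measConv (η : Measure ℝ) [IsFiniteMeasure η] {f : ℝ → ℂ}
    (hf : MemLp f 2 volume) : MemLp (measConv η f) 2 volume := by
  refine ⟨aestronglyMeasurable_measConv η hf.1, (eLpNorm_measConv_le η hf.1).trans_lt ?_⟩
  have := hf.2
  finiteness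

theorem measConv_add (η : Measure ℝ) [IsFiniteMeasure η] {f g : ℝ → ℂ}
    (hf : MemLp f 2 volume) (hg : MemLp g 2 volume) :
    measConv η (f + g) =ᵐ[volume] measConv η f + measConv η g := by
  filter_upwards [ae_integrable_comp_sub η hf, ae_integrable_comp_sub η hg] with x h1 h2
  exact integral_add h1 h2

theorem measConv_const_smul (η : Measure ℝ) (c : ℂ) (f : ℝ → ℂ) :
    measConv η (c • f) = c • measConv η f := by
  ext x
  exact integral_smul c _

/-- Convolution with a finite measure as a linear map on `L²(ℝ)`. -/
noncomputable def measConvₗ (η : Measure ℝ) [IsFiniteMeasure η] :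
    Lp ℂ 2 (volume : Measure ℝ) →ₗ[ℂ] Lp ℂ 2 (volume : Measure ℝ) where
  toFun f := (memLp_measConv η (Lp.memLp f)).toLp _
  map_add' f g := by
    rw [← MemLp.toLp_add, MemLp.toLp_eq_toLp_iff]
    exact (measConv_congr η (Lp.coeFn_add f g)).trans (measConv_add η (Lp.memLp f) (Lp.memLp g))
  map_smul' c f := by
    rw [RingHom.id_apply, ← MemLp.toLp_const_smul, MemLp.toLp_eq_toLp_iff, ← measConv_const_smul]
    exact measConv_congr η (Lp.coeFn_smul c f)

theorem norm_measConvₗ_le (η : Measure ℝ) [IsFiniteMeasure η] (f : Lp ℂ 2 (volume : Measure ℝ)) :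
    ‖measConvₗ η f‖ ≤ (η Set.univ).toReal * ‖f‖ := by
  have h := eLpNorm_measConv_le η (Lp.memLp f).1
  have h2 := Lp.eLpNorm_ne_top f
  have h3 : ‖measConvₗ η f‖ = (eLpNorm (measConv η f) 2 volume).toReal :=
    Lp.norm_toLp _ (memLp_measConv η (Lp.memLp f))
  rw [h3, Lp.norm_def, ← ENNReal.toReal_mul]
  exact ENNReal.toReal_mono (by finiteness) h

/-- Convolution with a finite measure as a bounded operator on `L²(ℝ)`. -/
noncomputable def measConvCLM (η : Measure ℝ) [IsFiniteMeasure η] :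
    Lp ℂ 2 (volume : Measure ℝ) →L[ℂ] Lp ℂ 2 (volume : Measure ℝ) :=
  (measConvₗ η).mkContinuous _ (norm_measConvₗ_le η)

theorem measConvCLM_toLp (η : Measure ℝ) [IsFiniteMeasure η] {f : ℝ → ℂ}
    (hf : MemLp f 2 volume) :
    measConvCLM η (hf.toLp f) = (memLp_measConv η hf).toLp _ := by
  change MemLp.toLp _ (memLp_measConv η (Lp.memLp _)) = _
  rw [MemLp.toLp_eq_toLp_iff]
  exact measConv_congr η hf.coeFn_toLp

/-! ### The maximal inequality for Poisson integrals -/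

/-- The unnormalized Poisson kernel `t / (t² + x²)`. -/
noncomputable def poissonKer (t x : ℝ) : ℝ≥0∞ := ENNReal.ofReal (t / (t ^ 2 + x ^ 2))

theorem measurable_poissonKer (t : ℝ) : Measurable (poissonKer t) := by
  unfold poissonKer; fun_prop

theorem poissonKer_neg (t x : ℝ) : poissonKer t (-x) = poissonKer t x := by
  simp [poissonKer]

/-- The Poisson integral of a nonnegative function, without the factor `1 / π`. -/
noncomputable def poissonInt (t : ℝ) (h : ℝ → ℝ≥0∞) (x : ℝ) : ℝ≥0∞ :=
  ∫⁻ y, poissonKer t (x - y) * h y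

theorem lintegral_poissonKer {t : ℝ} (ht : 0 < t) :
    ∫⁻ x, poissonKer t x = ENNReal.ofReal Real.pi := by
  have h1 : ∀ x : ℝ, t / (t ^ 2 + x ^ 2) = t⁻¹ * (1 + (x / t) ^ 2)⁻¹ := fun x => by
    field_simp
  have hi : Integrable fun x : ℝ => t⁻¹ * (1 + (x / t) ^ 2)⁻¹ :=
    (integrable_inv_one_add_sq.comp_div ht.ne').const_mul _
  unfold poissonKer
  rw [← ofReal_integral_eq_lintegral_ofReal (by simpa only [h1] using hi)
    (ae_of_all _ fun x => by positivity)]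
  simp only [h1]
  rw [integral_const_mul, Measure.integral_comp_div (fun x : ℝ => (1 + x ^ 2)⁻¹),
    integral_univ_inv_one_add_sq, abs_of_pos ht, smul_eq_mul, inv_mul_cancel_left₀ ht.ne']

/-- The pointwise inequality behind the semigroup property. In terms of reciprocals it
reads `1 / q_t(u + v) ≤ 2 (1 / q_s(u) + 1 / q_t(v))`, where `s ≤ t`. -/
theorem poissonKer_mul_le {s t : ℝ} (hs : 0 < s) (hst : s ≤ t) (u v : ℝ) :
    poissonKer s u * poissonKer t v ≤
      2 * poissonKer t (u + v) * (poissonKer s u + poissonKer t v) := by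
  have ht : 0 < t := hs.trans_le hst
  unfold poissonKer
  have h2 : (2 : ℝ≥0∞) = ENNReal.ofReal 2 := by simp
  rw [h2, ← ENNReal.ofReal_mul (by positivity), ← ENNReal.ofReal_mul (by positivity),
    ← ENNReal.ofReal_add (by positivity) (by positivity), ← ENNReal.ofReal_mul (by positivity)]
  refine ENNReal.ofReal_le_ofReal ?_
  have hA : 0 < s ^ 2 + u ^ 2 := by positivity
  have hB : 0 < t ^ 2 + v ^ 2 := by positivity
  have hC : 0 < t ^ 2 + (u + v) ^ 2 := by positivity
  have key : (t ^ 2 + (u + v) ^ 2) * s ≤ 2 * (t * (s ^ 2 + u ^ 2) + s * (t ^ 2 + v ^ 2)) := by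
    nlinarith [mul_nonneg hs.le (sq_nonneg (u - v)), mul_nonneg (sub_nonneg.2 hst) (sq_nonneg u),
      mul_pos hs (mul_pos hs ht), mul_pos hs (mul_pos ht ht)]
  have e1 : s / (s ^ 2 + u ^ 2) * (t / (t ^ 2 + v ^ 2))
      = s * t / ((s ^ 2 + u ^ 2) * (t ^ 2 + v ^ 2)) := by field_simp
  have e2 : 2 * (t / (t ^ 2 + (u + v) ^ 2)) * (s / (s ^ 2 + u ^ 2) + t / (t ^ 2 + v ^ 2))
      = 2 * (t * (s ^ 2 + u ^ 2) + s * (t ^ 2 + v ^ 2)) * t /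
        ((t ^ 2 + (u + v) ^ 2) * ((s ^ 2 + u ^ 2) * (t ^ 2 + v ^ 2))) := by field_simp; ring
  rw [e1, e2, div_le_div_iff₀ (by positivity) (by positivity)]
  have := mul_le_mul_of_nonneg_right key
    (show 0 ≤ t * ((s ^ 2 + u ^ 2) * (t ^ 2 + v ^ 2)) by positivity)
  nlinarith [this]

/-- The semigroup property of the Poisson kernels, up to a constant. -/
theorem lintegral_poissonKer_mul_le {s t : ℝ} (hs : 0 < s) (hst : s ≤ t) (x z : ℝ) :
    ∫⁻ y, poissonKer s (x - y) * poissonKer t (y - z)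
      ≤ ENNReal.ofReal (4 * Real.pi) * poissonKer t (x - z) := by
  have ht := hs.trans_le hst
  have m1 := measurable_poissonKer s
  have m2 := measurable_poissonKer t
  calc ∫⁻ y, poissonKer s (x - y) * poissonKer t (y - z)
      ≤ ∫⁻ y, 2 * poissonKer t (x - z) * (poissonKer s (x - y) + poissonKer t (y - z)) := by
        refine lintegral_mono fun y => (poissonKer_mul_le hs hst _ _).trans_eq ?_
        rw [show x - y + (y - z) = x - z by ring]
    _ = 2 * poissonKer t (x - z) * (ENNReal.ofReal Real.pi + ENNReal.ofReal Real.pi) := by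
        rw [lintegral_const_mul _ (by fun_prop), lintegral_add_left (by fun_prop),
          lintegral_sub_left_eq_self (poissonKer s), lintegral_sub_right_eq_self (poissonKer t),
          lintegral_poissonKer hs, lintegral_poissonKer ht]
    _ = _ := by
        rw [ENNReal.ofReal_mul (by norm_num)]
        simp
        ring

theorem measurable_poissonInt (t : ℝ) {h : ℝ → ℝ≥0∞} (hh : Measurable h) :
    Measurable (poissonInt t h) := by
  have m2 := measurable_poissonKer t
  unfold poissonInt
  exact Measurable.lintegral_prod_right' (f := fun p : ℝ × ℝ => poissonKer t (p.1 - p.2) * h p.2)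
    (by fun_prop)

theorem lintegral_mul_poissonInt_comm (t : ℝ) {g h : ℝ → ℝ≥0∞} (hg : Measurable g)
    (hh : Measurable h) :
    ∫⁻ x, g x * poissonInt t h x = ∫⁻ x, h x * poissonInt t g x := by
  have m2 := measurable_poissonKer t
  unfold poissonInt
  have e : ∀ {g h : ℝ → ℝ≥0∞}, Measurable h → ∀ x,
      g x * ∫⁻ y, poissonKer t (x - y) * h y = ∫⁻ y, g x * (poissonKer t (x - y) * h y) :=
    fun hh x => (lintegral_const_mul _ (by fun_prop)).symm
  simp_rw [e hh, e hg]
  rw [lintegral_lintegral_swap (by fun_prop)]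
  refine lintegral_congr fun y => lintegral_congr fun x => ?_
  rw [← poissonKer_neg t (x - y), neg_sub]
  ring

theorem lintegral_poissonInt_mul_poissonInt (s t : ℝ) {g h : ℝ → ℝ≥0∞} (hg : Measurable g)
    (hh : Measurable h) :
    ∫⁻ x, poissonInt s g x * poissonInt t h x
      = ∫⁻ x, g x * ∫⁻ z, (∫⁻ y, poissonKer s (x - y) * poissonKer t (y - z)) * h z := by
  have m1 := measurable_poissonKer s
  have m2 := measurable_poissonKer t
  rw [lintegral_congr fun x => mul_comm _ _,
    lintegral_mul_poissonInt_comm s (measurable_poissonInt t hh) hg]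
  refine lintegral_congr fun x => ?_
  congr 1
  calc _ = ∫⁻ y, ∫⁻ z, poissonKer s (x - y) * (poissonKer t (y - z) * h z) := by
        refine lintegral_congr fun y => ?_
        rw [lintegral_const_mul _ (by fun_prop)]
        rfl
    _ = _ := by
        rw [lintegral_lintegral_swap (by fun_prop)]
        refine lintegral_congr fun z => ?_
        rw [← lintegral_mul_const _ (by fun_prop)]
        exact lintegral_congr fun y => by ring

theorem lintegral_poissonInt_mul_poissonInt_le {s t : ℝ} (hs : 0 < s) (hst : s ≤ t)
    {g h : ℝ → ℝ≥0∞} (hg : Measurable g) (hh : Measurable h) :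
    ∫⁻ x, poissonInt s g x * poissonInt t h x
      ≤ ENNReal.ofReal (4 * Real.pi) * ∫⁻ x, g x * poissonInt t h x := by
  have m2 := measurable_poissonKer t
  rw [lintegral_poissonInt_mul_poissonInt s t hg hh,
    ← lintegral_const_mul' _ _ ENNReal.ofReal_ne_top]
  refine lintegral_mono fun x => ?_
  calc _ ≤ g x * ∫⁻ z, ENNReal.ofReal (4 * Real.pi) * (poissonKer t (x - z) * h z) := by
        refine mul_le_mul_right (lintegral_mono fun z => ?_) _
        rw [← mul_assoc]
        exact mul_le_mul_left (lintegral_poissonKer_mul_le hs hst x z) _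
    _ = _ := by
        rw [lintegral_const_mul _ (by fun_prop), poissonInt]
        ring

theorem lintegral_sq_poissonInt_le {t : ℝ} (ht : 0 < t) {h : ℝ → ℝ≥0∞} (hh : Measurable h) :
    ∫⁻ x, poissonInt t h x ^ 2 ≤ ENNReal.ofReal Real.pi ^ 2 * ∫⁻ x, h x ^ 2 := by
  have m2 := measurable_poissonKer t
  have h1 := lintegral_sq_conv_le (volume.withDensity (poissonKer t)) hh
  rw [withDensity_apply _ MeasurableSet.univ, Measure.restrict_univ, lintegral_poissonKer ht] at h1
  refine le_trans (le_of_eq ?_) h1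
  refine lintegral_congr fun x => ?_
  congr 1
  rw [lintegral_withDensity_eq_lintegral_mul _ m2 (by fun_prop), poissonInt,
    ← lintegral_sub_left_eq_self _ x]
  simp

/-- The maximal function over the first `N` of a sequence of Poisson integrals. -/
noncomputable def poissonMax (t : ℕ → ℝ) (N : ℕ) (h : ℝ → ℝ≥0∞) (x : ℝ) : ℝ≥0∞ :=
  (Finset.range N).sup fun k => poissonInt (t k) h x

theorem measurable_poissonMax (t : ℕ → ℝ) (N : ℕ) {h : ℝ → ℝ≥0∞} (hh : Measurable h) :
    Measurable (poissonMax t N h) := by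
  have : poissonMax t N h = (Finset.range N).sup fun k => poissonInt (t k) h := by
    ext x
    simp [poissonMax, Finset.sup_apply]
  rw [this]
  refine Finset.sup_induction measurable_const (fun a ha b hb => ha.sup hb)
    fun k _ => measurable_poissonInt (t k) hh

/-- A bound growing with the number of kernels, which only serves to show that a best constant
exists. -/
theorem lintegral_sq_poissonMax_le_crude {t : ℕ → ℝ} (ht : ∀ k, 0 < t k) (N : ℕ)
    {h : ℝ → ℝ≥0∞} (hh : Measurable h) :
    ∫⁻ x, poissonMax t N h x ^ 2 ≤ N * ENNReal.ofReal Real.pi ^ 2 * ∫⁻ x, h x ^ 2 := by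
  calc ∫⁻ x, poissonMax t N h x ^ 2 ≤ ∫⁻ x, ∑ k ∈ Finset.range N, poissonInt (t k) h x ^ 2 := by
        refine lintegral_mono fun x => ?_
        rcases Nat.eq_zero_or_pos N with rfl | hN
        · simp [poissonMax]
        · obtain ⟨k, hk, hk2⟩ := Finset.exists_mem_eq_sup (Finset.range N)
            (Finset.nonempty_range_iff.2 hN.ne') fun k => poissonInt (t k) h x
          rw [poissonMax, hk2]
          exact Finset.single_le_sum (f := fun k => poissonInt (t k) h x ^ 2)
            (fun _ _ => zero_le) hk
    _ = ∑ k ∈ Finset.range N, ∫⁻ x, poissonInt (t k) h x ^ 2 :=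
        lintegral_finsetSum _ fun k _ => (measurable_poissonInt (t k) hh).pow_const 2
    _ ≤ ∑ k ∈ Finset.range N, ENNReal.ofReal Real.pi ^ 2 * ∫⁻ x, h x ^ 2 :=
        Finset.sum_le_sum fun k _ => lintegral_sq_poissonInt_le (ht k) hh
    _ = _ := by simp [mul_assoc]

theorem exists_poissonInt_eq_poissonMax (t : ℕ → ℝ) {N : ℕ} (hN : 0 < N) (h : ℝ → ℝ≥0∞) (x : ℝ) :
    ∃ k < N, poissonInt (t k) h x = poissonMax t N h x := by
  obtain ⟨k, hk, hk2⟩ := Finset.exists_mem_eq_sup (Finset.range N)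
    (Finset.nonempty_range_iff.2 hN.ne') fun k => poissonInt (t k) h x
  exact ⟨k, Finset.mem_range.1 hk, hk2.symm⟩

/-- Linearization of the maximal function: it is split into finitely many measurable pieces, on
each of which it is a single Poisson integral. -/
theorem exists_linearization (t : ℕ → ℝ) {N : ℕ} (hN : 0 < N) {h : ℝ → ℝ≥0∞} (hh : Measurable h) :
    ∃ u : ℕ → ℝ → ℝ≥0∞, (∀ k, Measurable (u k)) ∧
      (∀ x, ∑ k ∈ Finset.range N, u k x = poissonMax t N h x) ∧
      ∀ k x, u k x * poissonInt (t k) h x = u k x * poissonMax t N h x := by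
  classical
  set g := poissonMax t N h with hg
  have hgm : Measurable g := measurable_poissonMax t N hh
  set E : ℕ → Set ℝ := fun k =>
    {x | poissonInt (t k) h x = g x} ∩ ⋂ j < k, {x | poissonInt (t j) h x = g x}ᶜ with hE
  have hm : ∀ k, MeasurableSet {x | poissonInt (t k) h x = g x} := fun k =>
    measurableSet_eq_fun (measurable_poissonInt (t k) hh) hgm
  have hEm : ∀ k, MeasurableSet (E k) := fun k =>
    (hm k).inter (MeasurableSet.iInter fun j => MeasurableSet.iInter fun _ => (hm j).compl)
  refine ⟨fun k => (E k).indicator g, fun k => hgm.indicator (hEm k), fun x => ?_, fun k x => ?_⟩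
  · have hex : ∃ k, k < N ∧ poissonInt (t k) h x = g x := exists_poissonInt_eq_poissonMax t hN h x
    have hk := Nat.find_spec hex
    set k := Nat.find hex with hkdef
    have hxk : x ∈ E k := by
      refine ⟨hk.2, Set.mem_iInter₂.2 fun j hj hj2 => ?_⟩
      exact Nat.find_min hex hj ⟨hj.trans hk.1, hj2⟩
    rw [Finset.sum_eq_single_of_mem k (Finset.mem_range.2 hk.1)]
    · exact Set.indicator_of_mem hxk _
    intro l _ hlk
    refine Set.indicator_of_notMem (fun hxl => ?_) _
    rcases lt_or_gt_of_ne hlk with hlt | hlt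
    · exact Set.mem_iInter₂.1 hxk.2 l hlt hxl.1
    · exact Set.mem_iInter₂.1 hxl.2 k hlt hxk.1
  · by_cases hx : x ∈ E k
    · rw [hx.1]
    · simp [hx]

/-- The bound for the adjoint `u ↦ ∑ P_k u_k` of the linearized maximal operator: in each product
`⟨P_k u_k, P_l u_l⟩` the kernel with the smaller parameter is absorbed by the other one. -/
theorem lintegral_sq_sum_poissonInt_le {t : ℕ → ℝ} (ht : ∀ k, 0 < t k) (hanti : Antitone t) (N : ℕ)
    {u : ℕ → ℝ → ℝ≥0∞} (hu : ∀ k, Measurable (u k)) :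
    ∫⁻ x, (∑ k ∈ Finset.range N, poissonInt (t k) (u k) x) ^ 2
      ≤ ENNReal.ofReal (8 * Real.pi) * ∫⁻ x, (∑ k ∈ Finset.range N, u k x) *
          poissonMax t N (fun x => ∑ k ∈ Finset.range N, u k x) x := by
  set c := ENNReal.ofReal (4 * Real.pi) with hc
  have hP : ∀ k l, Measurable (poissonInt (t k) (u l)) := fun k l => measurable_poissonInt _ (hu l)
  have hkl : ∀ k l, ∫⁻ x, poissonInt (t k) (u k) x * poissonInt (t l) (u l) x
      ≤ c * (∫⁻ x, u k x * poissonInt (t k) (u l) x) +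
        c * (∫⁻ x, u l x * poissonInt (t l) (u k) x) := by
    intro k l
    rcases le_total k l with h | h
    · refine le_trans ?_ le_self_add
      rw [lintegral_mul_poissonInt_comm (t k) (hu k) (hu l),
        lintegral_congr fun x => mul_comm (poissonInt (t k) (u k) x) _]
      exact lintegral_poissonInt_mul_poissonInt_le (ht l) (hanti h) (hu l) (hu k)
    · refine le_trans ?_ le_add_self
      rw [lintegral_mul_poissonInt_comm (t l) (hu l) (hu k)]
      exact lintegral_poissonInt_mul_poissonInt_le (ht k) (hanti h) (hu k) (hu l)
  have hsum : ∀ k x, ∑ l ∈ Finset.range N, poissonInt (t k) (u l) x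
      = poissonInt (t k) (fun x => ∑ l ∈ Finset.range N, u l x) x := by
    intro k x
    have m2 := measurable_poissonKer (t k)
    unfold poissonInt
    simp_rw [Finset.mul_sum]
    rw [lintegral_finsetSum _ fun l _ => by have := hu l; fun_prop]
  calc ∫⁻ x, (∑ k ∈ Finset.range N, poissonInt (t k) (u k) x) ^ 2
      = ∑ k ∈ Finset.range N, ∑ l ∈ Finset.range N,
          ∫⁻ x, poissonInt (t k) (u k) x * poissonInt (t l) (u l) x := by
        simp_rw [sq, Finset.sum_mul_sum]
        rw [lintegral_finsetSum _ fun k _ =>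
          Finset.measurable_fun_sum _ fun l _ => (hP k k).fun_mul (hP l l)]
        refine Finset.sum_congr rfl fun k _ => ?_
        rw [lintegral_finsetSum _ fun l _ => (hP k k).fun_mul (hP l l)]
    _ ≤ ∑ k ∈ Finset.range N, ∑ l ∈ Finset.range N,
          (c * (∫⁻ x, u k x * poissonInt (t k) (u l) x) +
            c * (∫⁻ x, u l x * poissonInt (t l) (u k) x)) :=
        Finset.sum_le_sum fun k _ => Finset.sum_le_sum fun l _ => hkl k l
    _ = 2 * c * ∑ k ∈ Finset.range N, ∑ l ∈ Finset.range N,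
          ∫⁻ x, u k x * poissonInt (t k) (u l) x := by
        simp_rw [Finset.sum_add_distrib]
        rw [Finset.sum_comm (f := fun k l => c * ∫⁻ x, u l x * poissonInt (t l) (u k) x)]
        simp_rw [← Finset.mul_sum]
        ring
    _ = 2 * c * ∫⁻ x, ∑ k ∈ Finset.range N, u k x *
          poissonInt (t k) (fun x => ∑ l ∈ Finset.range N, u l x) x := by
        rw [lintegral_finsetSum _ fun k _ => (hu k).fun_mul
          (measurable_poissonInt _ (Finset.measurable_fun_sum _ fun l _ => hu l))]
        congr 1
        refine Finset.sum_congr rfl fun k _ => ?_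
        simp_rw [← hsum, Finset.mul_sum]
        rw [lintegral_finsetSum _ fun l _ => (hu k).fun_mul (hP k l)]
    _ ≤ _ := by
        have h2 : 2 * c = ENNReal.ofReal (8 * Real.pi) := by
          rw [hc, show (2 : ℝ≥0∞) = ENNReal.ofReal 2 by simp, ← ENNReal.ofReal_mul (by norm_num)]
          congr 1; ring
        rw [h2]
        gcongr with x
        rw [Finset.sum_mul]
        refine Finset.sum_le_sum fun k hk => ?_
        gcongr
        exact Finset.le_sup (f := fun k => poissonInt (t k) _ x) hk

/-- The `TT*` step: an `L²` bound for the maximal function improves itself. -/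
theorem lintegral_sq_poissonMax_improve {t : ℕ → ℝ} (ht : ∀ k, 0 < t k) (hanti : Antitone t)
    {N : ℕ} (hN : 0 < N) {K : ℝ≥0∞}
    (hK : ∀ h : ℝ → ℝ≥0∞, Measurable h → ∫⁻ x, h x ^ 2 ≠ ∞ →
      ∫⁻ x, poissonMax t N h x ^ 2 ≤ K * ∫⁻ x, h x ^ 2)
    {f : ℝ → ℝ≥0∞} (hf : Measurable f) (hMf : ∫⁻ x, poissonMax t N f x ^ 2 ≠ ∞) :
    (∫⁻ x, poissonMax t N f x ^ 2) ^ 4 ≤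
      (∫⁻ x, f x ^ 2) ^ 2 * (ENNReal.ofReal (8 * Real.pi) ^ 2 * K) *
        (∫⁻ x, poissonMax t N f x ^ 2) ^ 2 := by
  obtain ⟨u, hu, hu1, hu2⟩ := exists_linearization t hN hf
  set g := poissonMax t N f with hg
  have hgm : Measurable g := measurable_poissonMax t N hf
  set S := ∫⁻ x, (∑ k ∈ Finset.range N, poissonInt (t k) (u k) x) ^ 2 with hS
  have hP : ∀ k, Measurable (poissonInt (t k) (u k)) := fun k => measurable_poissonInt _ (hu k)
  have h1 : ∫⁻ x, g x ^ 2 = ∫⁻ x, f x * ∑ k ∈ Finset.range N, poissonInt (t k) (u k) x := by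
    calc ∫⁻ x, g x ^ 2 = ∫⁻ x, ∑ k ∈ Finset.range N, u k x * poissonInt (t k) f x := by
          refine lintegral_congr fun x => ?_
          simp_rw [hu2, ← Finset.sum_mul]
          rw [hu1, sq]
      _ = ∑ k ∈ Finset.range N, ∫⁻ x, f x * poissonInt (t k) (u k) x := by
          rw [lintegral_finsetSum _ fun k _ => (hu k).fun_mul (measurable_poissonInt _ hf)]
          exact Finset.sum_congr rfl fun k _ => lintegral_mul_poissonInt_comm (t k) (hu k) hf
      _ = _ := by
          simp_rw [Finset.mul_sum]
          rw [lintegral_finsetSum _ fun k _ => hf.fun_mul (hP k)]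
  have h2 : (∫⁻ x, g x ^ 2) ^ 2 ≤ (∫⁻ x, f x ^ 2) * S := by
    rw [h1]
    exact lintegral_mul_sq_le _ hf.aemeasurable
      (Finset.measurable_fun_sum _ fun k _ => hP k).aemeasurable
  have h3 : S ≤ ENNReal.ofReal (8 * Real.pi) * ∫⁻ x, g x * poissonMax t N g x := by
    have h := lintegral_sq_sum_poissonInt_le ht hanti N hu
    simp_rw [hu1] at h
    exact h
  have h4 : (∫⁻ x, g x * poissonMax t N g x) ^ 2 ≤
      (∫⁻ x, g x ^ 2) * (K * ∫⁻ x, g x ^ 2) :=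
    (lintegral_mul_sq_le _ hgm.aemeasurable (measurable_poissonMax t N hgm).aemeasurable).trans
      (mul_le_mul_right (hK g hgm hMf) _)
  calc (∫⁻ x, g x ^ 2) ^ 4 = ((∫⁻ x, g x ^ 2) ^ 2) ^ 2 := by rw [← pow_mul]
    _ ≤ ((∫⁻ x, f x ^ 2) * (ENNReal.ofReal (8 * Real.pi) * ∫⁻ x, g x * poissonMax t N g x)) ^ 2 := by
        gcongr
        exact h2.trans (mul_le_mul_right h3 _)
    _ = (∫⁻ x, f x ^ 2) ^ 2 * ENNReal.ofReal (8 * Real.pi) ^ 2 *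
          (∫⁻ x, g x * poissonMax t N g x) ^ 2 := by ring
    _ ≤ (∫⁻ x, f x ^ 2) ^ 2 * ENNReal.ofReal (8 * Real.pi) ^ 2 *
          ((∫⁻ x, g x ^ 2) * (K * ∫⁻ x, g x ^ 2)) := by gcongr
    _ = _ := by ring

/-- The maximal inequality for finitely many Poisson integrals, with a constant independent of their
number: the best constant `K` satisfies `K ≤ √(c² K)`. -/
theorem lintegral_sq_poissonMax_le {t : ℕ → ℝ} (ht : ∀ k, 0 < t k) (hanti : Antitone t) (N : ℕ)
    {f : ℝ → ℝ≥0∞} (hf : Measurable f) :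
    ∫⁻ x, poissonMax t N f x ^ 2 ≤ ENNReal.ofReal (8 * Real.pi) ^ 2 * ∫⁻ x, f x ^ 2 := by
  rcases Nat.eq_zero_or_pos N with rfl | hN
  · simp [poissonMax]
  set c : ℝ≥0 := Real.toNNReal (8 * Real.pi) with hc
  have hc0 : c ≠ 0 := by
    rw [hc, Ne, Real.toNNReal_eq_zero, not_le]
    positivity
  change _ ≤ (c : ℝ≥0∞) ^ 2 * _
  rcases eq_or_ne (∫⁻ x, f x ^ 2) ∞ with hft | hft
  · rw [hft, ENNReal.mul_top (by simpa using hc0)]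
    exact le_top
  -- the best constant; finiteness of `∫ h²` makes the set of admissible constants closed
  set S : Set ℝ≥0 := {K | ∀ h : ℝ → ℝ≥0∞, Measurable h → ∫⁻ x, h x ^ 2 ≠ ∞ →
    ∫⁻ x, poissonMax t N h x ^ 2 ≤ K * ∫⁻ x, h x ^ 2} with hS
  have himp : ∀ K ∈ S, NNReal.sqrt (c ^ 2 * K) ∈ S := by
    intro K hK h hh hFt
    have hAF : ∫⁻ x, poissonMax t N h x ^ 2 ≤ K * ∫⁻ x, h x ^ 2 := hK h hh hFt
    have hAt : ∫⁻ x, poissonMax t N h x ^ 2 ≠ ∞ := ne_top_of_le_ne_top (by finiteness) hAF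
    have h1 := lintegral_sq_poissonMax_improve ht hanti hN hK hh hAt
    set A := ∫⁻ x, poissonMax t N h x ^ 2 with hA
    set F := ∫⁻ x, h x ^ 2 with hF
    change A ^ 4 ≤ F ^ 2 * ((c : ℝ≥0∞) ^ 2 * K) * A ^ 2 at h1
    rcases eq_or_ne A 0 with h0 | h0
    · simp [h0]
    rw [← ENNReal.pow_le_pow_left_iff two_ne_zero, mul_pow]
    have h2 : (NNReal.sqrt (c ^ 2 * K) : ℝ≥0∞) ^ 2 = (c : ℝ≥0∞) ^ 2 * K := by
      rw [← ENNReal.coe_pow, NNReal.sq_sqrt]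
      push_cast
      rfl
    rw [h2, mul_comm _ (F ^ 2)]
    have h3 : A ^ 2 * A ^ 2 ≤ F ^ 2 * ((c : ℝ≥0∞) ^ 2 * K) * A ^ 2 := by rwa [← pow_add]
    exact (ENNReal.mul_le_mul_iff_left (pow_ne_zero 2 h0) (ENNReal.pow_ne_top hAt)).1 h3
  have hne : S.Nonempty := by
    refine ⟨N * (Real.toNNReal Real.pi) ^ 2, fun h hh _ => ?_⟩
    have := lintegral_sq_poissonMax_le_crude ht N hh
    push_cast
    exact this
  have hclosed : IsClosed S := by
    simp only [hS, Set.ofPred_forall]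
    refine isClosed_iInter fun h => isClosed_iInter fun _ => isClosed_iInter fun hF => ?_
    exact isClosed_le continuous_const
      ((ENNReal.continuous_mul_const hF).comp ENNReal.continuous_coe)
  have hmem : sInf S ∈ S := hclosed.csInf_mem hne (OrderBot.bddBelow S)
  have hle : sInf S ≤ c ^ 2 := by
    have h1 := csInf_le (OrderBot.bddBelow S) (himp _ hmem)
    set K := sInf S
    have h2 : K ^ 2 ≤ c ^ 2 * K := by
      calc K ^ 2 ≤ NNReal.sqrt (c ^ 2 * K) ^ 2 := by gcongr
        _ = _ := NNReal.sq_sqrt _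
    rcases eq_or_ne K 0 with h0 | h0
    · simp [h0]
    · rw [sq] at h2
      exact le_of_mul_le_mul_right h2 (pos_iff_ne_zero.2 h0)
  calc _ ≤ _ := hmem f hf hft
    _ ≤ _ := by
      gcongr
      exact_mod_cast hle

/-- The maximal inequality for Poisson integrals along a decreasing sequence. -/
theorem lintegral_sq_iSup_poissonInt_le {t : ℕ → ℝ} (ht : ∀ k, 0 < t k) (hanti : Antitone t)
    {f : ℝ → ℝ≥0∞} (hf : Measurable f) :
    ∫⁻ x, (⨆ k, poissonInt (t k) f x) ^ 2 ≤ ENNReal.ofReal (8 * Real.pi) ^ 2 * ∫⁻ x, f x ^ 2 := by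
  have h1 : ∀ x, (⨆ k, poissonInt (t k) f x) ^ 2 ≤ ⨆ N, poissonMax t N f x ^ 2 := by
    intro x
    have h2 : (⨆ k, poissonInt (t k) f x) ≤ ⨆ N, poissonMax t N f x :=
      iSup_le fun k => le_iSup_of_le (k + 1)
        (Finset.le_sup (f := fun k => poissonInt (t k) f x) (Finset.self_mem_range_succ k))
    calc _ ≤ (⨆ N, poissonMax t N f x) ^ 2 := by gcongr
      _ = _ := Monotone.map_iSup_of_continuousAt
          (f := fun y : ℝ≥0∞ => y ^ 2) (ENNReal.continuous_pow 2).continuousAt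
          (fun _ _ h => pow_le_pow_left' h 2) (by simp)
  calc _ ≤ ∫⁻ x, ⨆ N, poissonMax t N f x ^ 2 := lintegral_mono h1
    _ = ⨆ N, ∫⁻ x, poissonMax t N f x ^ 2 := by
        refine lintegral_iSup (fun N => (measurable_poissonMax t N hf).pow_const 2) ?_
        intro N M hNM x
        refine pow_le_pow_left' (Finset.sup_mono ?_) 2
        simpa using hNM
    _ ≤ _ := iSup_le fun N => lintegral_sq_poissonMax_le ht hanti N hf

/-! ### Plancherel's theorem and Fourier multipliers -/

section

open FourierTransform SchwartzMap

/-- Plancherel's theorem for the integral inverse Fourier transform on `L¹ ∩ L²`. -/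
theorem eLpNorm_fourierInv_eq {G : ℝ → ℂ} (h1 : Integrable G) (h2 : MemLp G 2 volume) :
    eLpNorm (𝓕⁻ G) 2 volume = eLpNorm G 2 volume := by
  set H : Lp ℂ 2 (volume : Measure ℝ) := 𝓕⁻ (h2.toLp G) with hH
  have hcont : Continuous (𝓕⁻ G) :=
    VectorFourier.fourierIntegral_continuous Real.continuous_fourierChar
      (by simp only [LinearMap.neg_apply, innerₗ_apply_apply]; fun_prop) h1
  -- the two inverse transforms agree, since they agree as tempered distributions
  have hae : ∀ᵐ x, H x = 𝓕⁻ G x := by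
    refine ae_eq_of_integral_contDiff_smul_eq
      ((Lp.memLp H).locallyIntegrable (by norm_num)) hcont.locallyIntegrable fun g hg hgc => ?_
    have hgc' : HasCompactSupport fun x => (g x : ℂ) := hgc.comp_left Complex.ofReal_zero
    have hg' : ContDiff ℝ (⊤ : ℕ∞) fun x => (g x : ℂ) := Complex.ofRealCLM.contDiff.comp hg
    set ψ : 𝓢(ℝ, ℂ) := hgc'.toSchwartzMap hg' with hψ
    have hψg : ∀ x, ψ x = (g x : ℂ) := fun x => rfl
    have e1 : ∫ x, g x • H x = Lp.toTemperedDistribution H ψ := by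
      rw [Lp.toTemperedDistribution_apply]
      simp [hψg]
    have e2 : Lp.toTemperedDistribution H ψ = ∫ x, (𝓕⁻ ψ) x • G x := by
      rw [hH, ← Lp.fourierInv_toTemperedDistribution_eq, TemperedDistribution.fourierInv_apply,
        Lp.toTemperedDistribution_apply]
      refine integral_congr_ae ?_
      filter_upwards [h2.coeFn_toLp] with x hx
      rw [hx]
    have e3 : ∫ x, (𝓕⁻ (ψ : ℝ → ℂ)) x • G x = ∫ x, ψ x • 𝓕⁻ G x := by
      have := VectorFourier.integral_fourierIntegral_smul_eq_flip (μ := (volume : Measure ℝ))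
        (ν := (volume : Measure ℝ)) (L := -innerₗ ℝ) Real.continuous_fourierChar
        (by simp only [LinearMap.neg_apply, innerₗ_apply_apply]; fun_prop) ψ.integrable h1
      have hflip : (-innerₗ ℝ : ℝ →ₗ[ℝ] ℝ →ₗ[ℝ] ℝ).flip = -innerₗ ℝ := by
        ext; simp
      rw [hflip] at this
      exact this
    rw [e1, e2, SchwartzMap.fourierInv_coe, e3]
    simp [hψg]
  rw [← eLpNorm_congr_ae hae, ← eLpNorm_congr_ae h2.coeFn_toLp]
  have hn : ‖H‖ = ‖h2.toLp G‖ := (Lp.fourierTransformₗᵢ ℝ ℂ).symm.norm_map _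
  rw [Lp.norm_def, Lp.norm_def] at hn
  exact (ENNReal.toReal_eq_toReal_iff' (Lp.eLpNorm_ne_top _) (Lp.eLpNorm_ne_top _)).1 hn

/-- The character `x ↦ e^{2πix}` with values in `ℂ`. -/
noncomputable def fourierExp (x : ℝ) : ℂ := Complex.exp (↑(2 * Real.pi * x) * Complex.I)

@[simp]
theorem norm_fourierExp (x : ℝ) : ‖fourierExp x‖ = 1 := Complex.norm_exp_ofReal_mul_I _

@[fun_prop]
theorem continuous_fourierExp : Continuous fourierExp := by unfold fourierExp; fun_prop

theorem fourierExp_add (x y : ℝ) : fourierExp (x + y) = fourierExp x * fourierExp y := by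
  rw [fourierExp, fourierExp, fourierExp, ← Complex.exp_add]
  congr 1
  push_cast
  ring

theorem fourierChar_smul (x : ℝ) (z : ℂ) : 𝐞 x • z = fourierExp x * z := by
  rw [Circle.smul_def, Real.fourierChar_apply, smul_eq_mul, fourierExp]

/-- The Fourier transform `ξ ↦ ∫ e^{-2πi y ξ} dη(y)` of a measure. -/
noncomputable def fourierMeas (η : Measure ℝ) (ξ : ℝ) : ℂ := ∫ y, fourierExp (-(y * ξ)) ∂η

theorem norm_fourierMeas_le (η : Measure ℝ) (ξ : ℝ) : ‖fourierMeas η ξ‖ ≤ η.real Set.univ := by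
  refine (norm_integral_le_integral_norm _).trans ?_
  simp

theorem stronglyMeasurable_fourierMeas (η : Measure ℝ) [SFinite η] :
    StronglyMeasurable (fourierMeas η) := by
  have : StronglyMeasurable fun p : ℝ × ℝ => fourierExp (-(p.2 * p.1)) :=
    (continuous_fourierExp.comp (by fun_prop)).stronglyMeasurable
  exact this.integral_prod_right'

/-- On Schwartz functions, convolution with a finite measure is the Fourier multiplier with the
Fourier transform of the measure as symbol. -/
theorem measConv_eq_fourierInv (η : Measure ℝ) [IsFiniteMeasure η] (f : 𝓢(ℝ, ℂ)) :
    measConv η f = 𝓕⁻ (fun ξ => fourierMeas η ξ * 𝓕 f ξ) := by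
  ext x
  have hf : ∀ z, f z = ∫ v, fourierExp (v * z) * 𝓕 f v := by
    intro z
    have h : 𝓕⁻ (𝓕 f) z = f z := by rw [fourierInv_fourier_eq]
    rw [← h, SchwartzMap.fourierInv_coe, Real.fourierInv_eq]
    simp only [Real.inner_apply, fourierChar_smul]
  have hint : Integrable (Function.uncurry fun y v : ℝ => fourierExp (v * (x - y)) * 𝓕 f v)
      (η.prod volume) := by
    have h1 : Integrable (fun p : ℝ × ℝ => (1 : ℂ) * 𝓕 f p.2) (η.prod volume) :=
      (integrable_const (1 : ℂ)).mul_prod (𝓕 f).integrable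
    refine h1.mono ?_ (ae_of_all _ fun p => ?_)
    · refine Continuous.aestronglyMeasurable ?_
      exact (continuous_fourierExp.comp (by fun_prop)).mul
        ((𝓕 f).continuous.comp continuous_snd)
    · simp [Function.uncurry]
  unfold measConv
  simp_rw [hf]
  rw [integral_integral_swap hint, Real.fourierInv_eq]
  refine integral_congr_ae (ae_of_all _ fun v => ?_)
  simp only [fourierChar_smul, fourierMeas]
  rw [← integral_mul_const, ← integral_const_mul]
  refine integral_congr_ae (ae_of_all _ fun y => ?_)
  simp only [Real.inner_apply]
  rw [← mul_assoc, ← fourierExp_add]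
  congr 2
  ring

theorem memLp_fourierMeas_sub_mul (η ρ : Measure ℝ) [IsFiniteMeasure η] [IsFiniteMeasure ρ]
    {g : ℝ → ℂ} {p : ℝ≥0∞} (hg : MemLp g p volume) :
    MemLp (fun ξ => (fourierMeas η ξ - fourierMeas ρ ξ) * g ξ) p volume := by
  refine hg.of_le_mul (c := η.real Set.univ + ρ.real Set.univ)
    (((stronglyMeasurable_fourierMeas η).sub
      (stronglyMeasurable_fourierMeas ρ)).aestronglyMeasurable.mul hg.1) (ae_of_all _ fun ξ => ?_)
  rw [norm_mul]
  gcongr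
  exact (norm_sub_le _ _).trans
    (add_le_add (norm_fourierMeas_le η ξ) (norm_fourierMeas_le ρ ξ))

theorem eLpNorm_measConv_sub_schwartz (η ρ : Measure ℝ) [IsFiniteMeasure η] [IsFiniteMeasure ρ]
    (f : 𝓢(ℝ, ℂ)) :
    eLpNorm (measConv η f - measConv ρ f) 2 volume =
      eLpNorm (fun ξ => (fourierMeas η ξ - fourierMeas ρ ξ) * 𝓕 f ξ) 2 volume := by
  have hm : ∀ η : Measure ℝ, IsFiniteMeasure η →
      Integrable fun ξ => fourierMeas η ξ * 𝓕 f ξ := fun η _ =>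
    (𝓕 f).integrable.bdd_mul (c := η.real Set.univ)
      (stronglyMeasurable_fourierMeas η).aestronglyMeasurable
      (ae_of_all _ fun ξ => norm_fourierMeas_le η ξ)
  have hsub : measConv η f - measConv ρ f =
      𝓕⁻ (fun ξ => (fourierMeas η ξ - fourierMeas ρ ξ) * 𝓕 f ξ) := by
    rw [measConv_eq_fourierInv, measConv_eq_fourierInv]
    ext x
    simp only [Pi.sub_apply, Real.fourierInv_eq, sub_mul, smul_sub]
    rw [integral_sub]
    · simpa using (Real.fourierIntegral_convergent_iff (-x)).2 (hm η inferInstance)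
    · simpa using (Real.fourierIntegral_convergent_iff (-x)).2 (hm ρ inferInstance)
  rw [hsub]
  exact eLpNorm_fourierInv_eq
    (memLp_one_iff_integrable.1 (memLp_fourierMeas_sub_mul η ρ ((𝓕 f).memLp 1)))
    (memLp_fourierMeas_sub_mul η ρ ((𝓕 f).memLp 2))

theorem sum_lintegral_sq_measConv_sub_schwartz {ι : Type*} (s : Finset ι) (η ρ : ι → Measure ℝ)
    [∀ k, IsFiniteMeasure (η k)] [∀ k, IsFiniteMeasure (ρ k)] {A : ℝ≥0}
    (hA : ∀ ξ, ∑ k ∈ s, ‖fourierMeas (η k) ξ - fourierMeas (ρ k) ξ‖ₑ ^ 2 ≤ A) (f : 𝓢(ℝ, ℂ)) :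
    ∑ k ∈ s, eLpNorm (measConv (η k) f - measConv (ρ k) f) 2 volume ^ 2
      ≤ A * eLpNorm f 2 volume ^ 2 := by
  have hn : eLpNorm f 2 (volume : Measure ℝ) = eLpNorm (𝓕 f : 𝓢(ℝ, ℂ)) 2 (volume : Measure ℝ) := by
    have h := eLpNorm_fourierInv_eq (𝓕 f).integrable ((𝓕 f).memLp 2)
    rw [← SchwartzMap.fourierInv_coe, fourierInv_fourier_eq] at h
    exact h
  rw [hn]
  simp_rw [eLpNorm_measConv_sub_schwartz, eLpNorm_two_sq, enorm_mul, mul_pow]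
  have hm : Measurable fun ξ => ‖𝓕 f ξ‖ₑ ^ 2 := (𝓕 f).continuous.measurable.enorm.pow_const 2
  rw [← lintegral_finsetSum, ← lintegral_const_mul _ hm]
  · refine lintegral_mono fun ξ => ?_
    rw [← Finset.sum_mul]
    gcongr
    exact hA ξ
  · intro k _
    exact ((((stronglyMeasurable_fourierMeas (η k)).sub
      (stronglyMeasurable_fourierMeas (ρ k))).measurable.enorm.pow_const 2).mul hm)

/-- If the multipliers are square summable, uniformly in the frequency, then the
square function of the differences of the convolutions is bounded on `L²`. -/
theorem sum_eLpNorm_sq_measConv_sub_le {ι : Type*} (s : Finset ι) (η ρ : ι → Measure ℝ)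
    [∀ k, IsFiniteMeasure (η k)] [∀ k, IsFiniteMeasure (ρ k)] {A : ℝ≥0}
    (hA : ∀ ξ, ∑ k ∈ s, ‖fourierMeas (η k) ξ - fourierMeas (ρ k) ξ‖ₑ ^ 2 ≤ A) {f : ℝ → ℂ}
    (hf : MemLp f 2 volume) :
    ∑ k ∈ s, eLpNorm (measConv (η k) f - measConv (ρ k) f) 2 volume ^ 2
      ≤ A * eLpNorm f 2 volume ^ 2 := by
  have hconv : ∀ {f : ℝ → ℂ} (hf : MemLp f 2 volume) (k : ι),
      ‖(measConvCLM (η k) - measConvCLM (ρ k)) (hf.toLp f)‖ₑ =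
        eLpNorm (measConv (η k) f - measConv (ρ k) f) 2 volume := by
    intro f hf k
    rw [sub_apply, measConvCLM_toLp, measConvCLM_toLp, ← MemLp.toLp_sub,
      Lp.enorm_toLp]
  have key : ∀ F : Lp ℂ 2 (volume : Measure ℝ),
      ∑ k ∈ s, ‖(measConvCLM (η k) - measConvCLM (ρ k)) F‖ₑ ^ 2 ≤ A * ‖F‖ₑ ^ 2 := by
    intro F
    refine (SchwartzMap.denseRange_toLpCLM (F := ℂ) (p := 2) (μ := (volume : Measure ℝ))
      ENNReal.ofNat_ne_top).induction_on (p := fun F =>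
        ∑ k ∈ s, ‖(measConvCLM (η k) - measConvCLM (ρ k)) F‖ₑ ^ 2 ≤ A * ‖F‖ₑ ^ 2) F ?_ fun g => ?_
    · refine isClosed_le ?_ ?_
      · exact continuous_finsetSum _ fun k _ => (ENNReal.continuous_pow 2).comp
          (continuous_enorm.comp (ContinuousLinearMap.continuous _))
      · exact (ENNReal.continuous_const_mul ENNReal.coe_ne_top).comp
          ((ENNReal.continuous_pow 2).comp continuous_enorm)
    · have h := sum_lintegral_sq_measConv_sub_schwartz s η ρ hA g
      have e : SchwartzMap.toLpCLM ℝ ℂ 2 volume g = (g.memLp 2).toLp g := rfl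
      rw [e]
      simp_rw [hconv]
      rwa [Lp.enorm_toLp]
  have h := key (hf.toLp f)
  simp_rw [hconv] at h
  rwa [Lp.enorm_toLp] at h

end

/-! ### Fourier transforms of the partial Riesz products -/

theorem continuous_rieszPartial (n : ℕ → ℕ) (k : ℕ) : Continuous (rieszPartial n k) := by
  unfold rieszPartial; fun_prop

theorem rieszPartial_nonneg (n : ℕ → ℕ) (k : ℕ) (x : ℝ) : 0 ≤ rieszPartial n k x :=
  Finset.prod_nonneg fun m _ => by linarith [Real.neg_one_le_cos (2 * Real.pi * (n m : ℝ) * x)]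

theorem rieszPartial_one_sub (n : ℕ → ℕ) (k : ℕ) (x : ℝ) :
    rieszPartial n k (1 - x) = rieszPartial n k x := by
  unfold rieszPartial
  refine Finset.prod_congr rfl fun m _ => ?_
  rw [show 2 * Real.pi * (n m : ℝ) * (1 - x) = (n m : ℝ) * (2 * Real.pi) - 2 * Real.pi * n m * x by
    ring, Real.cos_nat_mul_two_pi_sub]

theorem rieszPartial_add_int (n : ℕ → ℕ) (k : ℕ) (x : ℝ) (j : ℤ) :
    rieszPartial n k (x + j) = rieszPartial n k x := by
  unfold rieszPartial
  refine Finset.prod_congr rfl fun m _ => ?_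
  rw [show 2 * Real.pi * (n m : ℝ) * (x + j) = 2 * Real.pi * n m * x +
    ((n m * j : ℤ) : ℝ) * (2 * Real.pi) by push_cast; ring, Real.cos_add_int_mul_two_pi]

theorem rieszPartial_succ (n : ℕ → ℕ) (k : ℕ) (x : ℝ) :
    (rieszPartial n (k + 1) x : ℂ) = rieszPartial n k x +
      1 / 2 * (rieszPartial n k x * fourierExp (x * n k) +
        rieszPartial n k x * fourierExp (-(x * n k))) := by
  rw [rieszPartial, Finset.prod_range_succ, ← rieszPartial]
  push_cast
  rw [Complex.cos, fourierExp, fourierExp]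
  push_cast
  ring_nf

/-- The Fourier transform of the partial Riesz product `p_k` with respect to a measure `η`. -/
noncomputable def rieszFourier (n : ℕ → ℕ) (η : Measure ℝ) (k : ℕ) (ξ : ℝ) : ℂ :=
  ∫ x, (rieszPartial n k x : ℂ) * fourierExp (-(x * ξ)) ∂η

theorem integrable_rieszPartial_mul (n : ℕ → ℕ) (η : Measure ℝ) (k : ℕ) {f : ℝ → ℂ}
    (hf : Integrable f η) : Integrable (fun x => (rieszPartial n k x : ℂ) * f x) η := by
  have := continuous_rieszPartial n k
  refine hf.bdd_mul (c := 2 ^ k) (Continuous.aestronglyMeasurable (by fun_prop))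
    (ae_of_all _ fun x => ?_)
  rw [Complex.norm_real, Real.norm_of_nonneg (rieszPartial_nonneg n k x)]
  exact rieszPartial_le n k x

theorem integrable_fourierExp (η : Measure ℝ) [IsFiniteMeasure η] (ξ : ℝ) :
    Integrable (fun x => fourierExp (-(x * ξ))) η := by
  refine (integrable_const (1 : ℝ)).mono' (Continuous.aestronglyMeasurable (by fun_prop))
    (ae_of_all _ fun x => by simp)

theorem rieszFourier_succ (n : ℕ → ℕ) (η : Measure ℝ) [IsFiniteMeasure η] (k : ℕ) (ξ : ℝ) :
    rieszFourier n η (k + 1) ξ = rieszFourier n η k ξ +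
      1 / 2 * (rieszFourier n η k (ξ - n k) + rieszFourier n η k (ξ + n k)) := by
  have hi : ∀ ξ, Integrable (fun x => (rieszPartial n k x : ℂ) * fourierExp (-(x * ξ))) η :=
    fun ξ => integrable_rieszPartial_mul n η k (integrable_fourierExp η ξ)
  unfold rieszFourier
  rw [← integral_add (hi _) (hi _), ← integral_const_mul,
    ← integral_add (hi _) (((hi _).fun_add (hi _)).const_mul _)]
  refine integral_congr_ae (ae_of_all _ fun x => ?_)
  simp only
  rw [rieszPartial_succ, show -(x * (ξ - n k)) = -(x * ξ) + x * n k by ring,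
    show -(x * (ξ + n k)) = -(x * ξ) + -(x * n k) by ring, fourierExp_add, fourierExp_add]
  ring

/-- The sum of the first `k` frequencies, the degree of the `k`-th partial Riesz product. -/
def freqSum (n : ℕ → ℕ) (k : ℕ) : ℕ := ∑ i ∈ Finset.range k, n i

theorem freqSum_succ (n : ℕ → ℕ) (k : ℕ) : freqSum n (k + 1) = freqSum n k + n k :=
  Finset.sum_range_succ _ _

theorem three_mul_freqSum_lt {n : ℕ → ℕ} (hpos : ∀ m, 0 < n m) (hg : ∀ m, 4 * n m ≤ n (m + 1))
    (k : ℕ) : 3 * freqSum n k < n k := by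
  induction k with
  | zero => simpa [freqSum] using hpos 0
  | succ k ih =>
    have := hg k
    rw [freqSum_succ]
    omega

theorem lt_freq {n : ℕ → ℕ} (hpos : ∀ m, 0 < n m) (hg : ∀ m, 4 * n m ≤ n (m + 1)) (k : ℕ) :
    k < n k := by
  induction k with
  | zero => exact hpos 0
  | succ k ih =>
    have := hg k
    omega

/-- If the Fourier transform of `η` vanishes at the frequencies of a group `T ⊇ ℤ` outside
`(-1, 1)`, then that of `p_k η` vanishes at those outside `(-S - 1, S + 1)`, `S = freqSum n k`. -/
theorem rieszFourier_eq_zero {n : ℕ → ℕ} {η : Measure ℝ} [IsFiniteMeasure η] {T : AddSubgroup ℝ}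
    (hT : ∀ m : ℕ, (m : ℝ) ∈ T) (h0 : ∀ ξ ∈ T, 1 ≤ |ξ| → rieszFourier n η 0 ξ = 0) (k : ℕ)
    {ξ : ℝ} (hξT : ξ ∈ T) (hξ : freqSum n k + 1 ≤ |ξ|) : rieszFourier n η k ξ = 0 := by
  induction k generalizing ξ with
  | zero => exact h0 ξ hξT (by simpa [freqSum] using hξ)
  | succ k ih =>
    rw [freqSum_succ] at hξ
    push_cast at hξ
    have hn : (0 : ℝ) ≤ n k := Nat.cast_nonneg _
    have h1 : |ξ| - n k ≤ |ξ - n k| := by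
      simpa [abs_of_nonneg hn] using abs_sub_abs_le_abs_sub ξ (n k)
    have h2 : |ξ| - n k ≤ |ξ + n k| := by
      simpa [abs_of_nonneg hn] using abs_sub_abs_le_abs_sub ξ (-(n k : ℝ))
    rw [rieszFourier_succ, ih hξT (by linarith), ih (T.sub_mem hξT (hT _)) (by linarith),
      ih (T.add_mem hξT (hT _)) (by linarith)]
    simp

/-- Passing from `p_k` to `p_{k+1}` changes the Fourier transform only near `± n_k`. -/
theorem rieszFourier_succ_eq {n : ℕ → ℕ} {η : Measure ℝ} [IsFiniteMeasure η] {T : AddSubgroup ℝ}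
    (hT : ∀ m : ℕ, (m : ℝ) ∈ T) (h0 : ∀ ξ ∈ T, 1 ≤ |ξ| → rieszFourier n η 0 ξ = 0) (k : ℕ)
    {ξ : ℝ} (hξT : ξ ∈ T) (hξ : freqSum n k + 1 ≤ |(|ξ| - n k)|) :
    rieszFourier n η (k + 1) ξ = rieszFourier n η k ξ := by
  have hn : |(n k : ℝ)| = n k := abs_of_nonneg (Nat.cast_nonneg _)
  have h1 : |(|ξ| - n k)| ≤ |ξ - n k| := by
    simpa [hn] using abs_abs_sub_abs_le_abs_sub ξ (n k)
  have h2 : |(|ξ| - n k)| ≤ |ξ + n k| := by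
    simpa [hn] using abs_abs_sub_abs_le_abs_sub ξ (-(n k : ℝ))
  rw [rieszFourier_succ,
    rieszFourier_eq_zero hT h0 k (T.sub_mem hξT (hT _)) (by linarith),
    rieszFourier_eq_zero hT h0 k (T.add_mem hξT (hT _)) (by linarith)]
  simp

/-! ### Weak convergence of the Riesz product -/

theorem integral_unitInterval_fourierExp_int {j : ℤ} (hj : j ≠ 0) :
    ∫ x in Set.Icc (0 : ℝ) 1, fourierExp (-(x * j)) = 0 := by
  rw [integral_Icc_eq_integral_Ioc, ← intervalIntegral.integral_of_le zero_le_one]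
  have hc : (-(2 * Real.pi * j) * Complex.I : ℂ) ≠ 0 := by
    simp [hj, Real.pi_ne_zero]
  have h : ∀ x : ℝ, fourierExp (-(x * j)) =
      Complex.exp ((-(2 * Real.pi * j) * Complex.I : ℂ) * x) := by
    intro x
    rw [fourierExp]
    push_cast
    ring_nf
  simp_rw [h]
  rw [integral_exp_mul_complex hc]
  have : Complex.exp ((-(2 * Real.pi * j) * Complex.I : ℂ) * (1 : ℝ)) = 1 := by
    rw [Complex.exp_eq_one_iff]
    exact ⟨-j, by push_cast; ring⟩
  rw [this]
  simp

/-- Lebesgue measure on `[0,1]`. -/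
noncomputable abbrev unitVol : Measure ℝ := volume.restrict (Set.Icc (0 : ℝ) 1)

theorem natCast_mem_range_intCast (m : ℕ) : (m : ℝ) ∈ (Int.castAddHom ℝ).range :=
  ⟨m, by simp⟩

theorem rieszFourier_unitVol_zero {n : ℕ → ℕ} :
    ∀ ξ ∈ (Int.castAddHom ℝ).range, 1 ≤ |ξ| → rieszFourier n unitVol 0 ξ = 0 := by
  rintro _ ⟨j, rfl⟩ hj
  have hj0 : j ≠ 0 := by
    rintro rfl
    norm_num at hj
  simpa [rieszFourier, rieszPartial] using integral_unitInterval_fourierExp_int hj0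

theorem rieszFourier_unitVol_succ {n : ℕ → ℕ} (hpos : ∀ m, 0 < n m)
    (hg : ∀ m, 4 * n m ≤ n (m + 1)) (j : ℤ) {k : ℕ} (hk : 2 * j.natAbs ≤ k) :
    rieszFourier n unitVol (k + 1) j = rieszFourier n unitVol k j := by
  refine rieszFourier_succ_eq natCast_mem_range_intCast rieszFourier_unitVol_zero k ⟨j, rfl⟩ ?_
  have h1 := three_mul_freqSum_lt hpos hg k
  have h2 := lt_freq hpos hg k
  have h3 : freqSum n k + 1 + j.natAbs ≤ n k := by omega
  have h4 : (freqSum n k : ℝ) + 1 + |(j : ℝ)| ≤ n k := by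
    rw [← Int.cast_abs, Int.abs_eq_natAbs]
    exact_mod_cast h3
  rw [abs_of_nonpos (by linarith [(freqSum n k).cast_nonneg (α := ℝ)])]
  linarith

theorem exists_tendsto_rieszFourier_unitVol {n : ℕ → ℕ} (hpos : ∀ m, 0 < n m)
    (hg : ∀ m, 4 * n m ≤ n (m + 1)) (j : ℤ) :
    ∃ L, Tendsto (fun k => rieszFourier n unitVol k j) atTop (𝓝 L) := by
  refine ⟨rieszFourier n unitVol (2 * j.natAbs) j, tendsto_const_nhds.congr' ?_⟩
  filter_upwards [eventually_ge_atTop (2 * j.natAbs)] with k hk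
  induction k, hk using Nat.le_induction with
  | base => rfl
  | succ k hk ih => rw [rieszFourier_unitVol_succ hpos hg j hk, ih]

theorem integral_rieszPartial_unitVol {n : ℕ → ℕ} (hpos : ∀ m, 0 < n m)
    (hg : ∀ m, 4 * n m ≤ n (m + 1)) (k : ℕ) : ∫ x, rieszPartial n k x ∂unitVol = 1 := by
  have h : ∀ k, rieszFourier n unitVol k (0 : ℤ) = 1 := by
    intro k
    induction k with
    | zero => simp [rieszFourier, rieszPartial, fourierExp]
    | succ k ih => rw [rieszFourier_unitVol_succ hpos hg 0 (by simp), ih]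
  have h1 := h k
  simp only [rieszFourier, Int.cast_zero, mul_zero, neg_zero] at h1
  have h2 : fourierExp 0 = 1 := by simp [fourierExp]
  simp only [h2, mul_one] at h1
  rw [integral_complex_ofReal] at h1
  exact_mod_cast h1

theorem cauchySeq_integral_addCircle {n : ℕ → ℕ} (hpos : ∀ m, 0 < n m)
    (hg : ∀ m, 4 * n m ≤ n (m + 1)) (G : C(AddCircle (1 : ℝ), ℂ)) :
    CauchySeq fun k => ∫ x, (rieszPartial n k x : ℂ) * G (x : AddCircle (1 : ℝ)) ∂unitVol := by
  have : Fact ((0 : ℝ) < 1) := ⟨zero_lt_one⟩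
  have hint : ∀ (k : ℕ) (G : C(AddCircle (1 : ℝ), ℂ)), Integrable
      (fun x => (rieszPartial n k x : ℂ) * G (x : AddCircle (1 : ℝ))) unitVol := by
    intro k G
    refine integrable_rieszPartial_mul n _ k ?_
    exact (integrable_const ‖G‖).mono' (Continuous.aestronglyMeasurable
      (G.continuous.comp (AddCircle.continuous_mk' 1))) (ae_of_all _ fun x => G.norm_coe_le_norm _)
  have hspan : ∀ G ∈ Submodule.span ℂ (Set.range (@fourier 1)),
      CauchySeq fun k => ∫ x, (rieszPartial n k x : ℂ) * G (x : AddCircle (1 : ℝ)) ∂unitVol := by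
    intro G hG
    induction hG using Submodule.span_induction with
    | mem G hG =>
      obtain ⟨j, rfl⟩ := hG
      obtain ⟨L, hL⟩ := exists_tendsto_rieszFourier_unitVol hpos hg (-j)
      refine (hL.congr fun k => ?_).cauchySeq
      unfold rieszFourier
      refine integral_congr_ae (ae_of_all _ fun x => ?_)
      simp only [fourier_coe_apply, fourierExp]
      push_cast
      ring_nf
    | zero => simpa using cauchySeq_const (0 : ℂ)
    | add G H _ _ h1 h2 =>
      convert h1.add h2 using 2 with k
      simp only [ContinuousMap.add_apply, mul_add]
      exact integral_add (hint k G) (hint k H)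
    | smul c G _ h =>
      obtain ⟨L, hL⟩ := cauchySeq_tendsto_of_complete h
      refine ((hL.const_smul c).congr fun k => ?_).cauchySeq
      rw [← integral_smul]
      refine integral_congr_ae (ae_of_all _ fun x => ?_)
      simp only [ContinuousMap.smul_apply, smul_eq_mul]
      ring
  rw [Metric.cauchySeq_iff']
  intro ε hε
  have hG : G ∈ (Submodule.span ℂ (Set.range (@fourier 1))).topologicalClosure := by
    rw [span_fourier_closure_eq_top]
    trivial
  obtain ⟨H, hH, hGH⟩ := Metric.mem_closure_iff.1 hG (ε / 3) (by positivity)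
  have hbd : ∀ k, dist (∫ x, (rieszPartial n k x : ℂ) * G (x : AddCircle (1 : ℝ)) ∂unitVol)
      (∫ x, (rieszPartial n k x : ℂ) * H (x : AddCircle (1 : ℝ)) ∂unitVol) < ε / 3 := by
    intro k
    refine lt_of_le_of_lt ?_ hGH
    rw [dist_eq_norm, ← integral_sub (hint k G) (hint k H)]
    have hpi : Integrable (rieszPartial n k) unitVol :=
      (continuous_rieszPartial n k).continuousOn.integrableOn_compact isCompact_Icc
    calc _ ≤ ∫ x, rieszPartial n k x * dist G H ∂unitVol := by
          refine norm_integral_le_of_norm_le (hpi.mul_const _) (ae_of_all _ fun x => ?_)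
          rw [← mul_sub, norm_mul, Complex.norm_real,
            Real.norm_of_nonneg (rieszPartial_nonneg n k x), ← dist_eq_norm]
          exact mul_le_mul_of_nonneg_left (ContinuousMap.dist_apply_le_dist _)
            (rieszPartial_nonneg n k x)
      _ = dist G H := by rw [integral_mul_const, integral_rieszPartial_unitVol hpos hg, one_mul]
  obtain ⟨N, hN⟩ := Metric.cauchySeq_iff'.1 (hspan H hH) (ε / 3) (by positivity)
  refine ⟨N, fun k hk => ?_⟩
  have h1 := hbd k
  have h2 := hbd N
  rw [dist_comm] at h2
  have h3 := dist_triangle4 (∫ x, (rieszPartial n k x : ℂ) * G (x : AddCircle (1 : ℝ)) ∂unitVol)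
    (∫ x, (rieszPartial n k x : ℂ) * H (x : AddCircle (1 : ℝ)) ∂unitVol)
    (∫ x, (rieszPartial n N x : ℂ) * H (x : AddCircle (1 : ℝ)) ∂unitVol)
    (∫ x, (rieszPartial n N x : ℂ) * G (x : AddCircle (1 : ℝ)) ∂unitVol)
  linarith [hN k hk]

theorem integral_rieszPartial_mul_sub_half (n : ℕ → ℕ) (k : ℕ) :
    ∫ x, rieszPartial n k x * (x - 1 / 2) ∂unitVol = 0 := by
  rw [integral_Icc_eq_integral_Ioc, ← intervalIntegral.integral_of_le zero_le_one]
  have h := intervalIntegral.integral_comp_sub_left (a := 0) (b := 1)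
    (fun x => rieszPartial n k x * (x - 1 / 2)) 1
  simp only [rieszPartial_one_sub, sub_self, sub_zero] at h
  have h2 : ∀ x : ℝ, rieszPartial n k x * (1 - x - 1 / 2) =
      -(rieszPartial n k x * (x - 1 / 2)) := fun x => by ring
  simp only [h2, intervalIntegral.integral_neg] at h
  linarith

/-- The integrals of continuous functions on `[0,1]` against the partial Riesz products converge.
A continuous function is the sum of a `1`-periodic one and a multiple of `x - 1/2`, whose
integrals vanish by symmetry. -/
theorem exists_tendsto_integral_rieszPartial {n : ℕ → ℕ} (hpos : ∀ m, 0 < n m)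
    (hg : ∀ m, 4 * n m ≤ n (m + 1)) {f : ℝ → ℝ} (hf : Continuous f) :
    ∃ L, Tendsto (fun k => ∫ x, rieszPartial n k x * f x ∂unitVol) atTop (𝓝 L) := by
  have : Fact ((0 : ℝ) < 1) := ⟨zero_lt_one⟩
  set g : ℝ → ℂ := fun x => ((f x - (f 1 - f 0) * (x - 1 / 2) : ℝ) : ℂ) with hgdef
  have hgc : Continuous g := by fun_prop
  have hgp : g 0 = g (0 + 1) := by
    simp only [hgdef]
    congr 1
    ring_nf
  set G : C(AddCircle (1 : ℝ), ℂ) :=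
    ⟨AddCircle.liftIco 1 0 g, AddCircle.liftIco_continuous hgp hgc.continuousOn⟩ with hG
  obtain ⟨L, hL⟩ := cauchySeq_tendsto_of_complete (cauchySeq_integral_addCircle hpos hg G)
  refine ⟨L.re, ((Complex.continuous_re.tendsto L).comp hL).congr fun k => ?_⟩
  have hint : ∀ h : ℝ → ℝ, Continuous h → Integrable (fun x => rieszPartial n k x * h x) unitVol :=
    fun h hh =>
      ((continuous_rieszPartial n k).mul hh).continuousOn.integrableOn_compact isCompact_Icc
  have e1 : ∫ x, (rieszPartial n k x : ℂ) * G (x : AddCircle (1 : ℝ)) ∂unitVol =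
      ∫ x, ((rieszPartial n k x * (f x - (f 1 - f 0) * (x - 1 / 2)) : ℝ) : ℂ) ∂unitVol := by
    rw [integral_Icc_eq_integral_Ico, integral_Icc_eq_integral_Ico]
    refine setIntegral_congr_fun measurableSet_Ico fun x hx => ?_
    have hx' : x ∈ Set.Ico (0 : ℝ) (0 + 1) := by rwa [zero_add]
    have : G (x : AddCircle (1 : ℝ)) = g x :=
      AddCircle.liftIco_coe_apply (f := g) hx'
    simp only [this, hgdef]
    push_cast
    rfl
  simp only [Function.comp_apply]
  rw [e1, integral_complex_ofReal, Complex.ofReal_re]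
  have e2 : ∀ x, rieszPartial n k x * (f x - (f 1 - f 0) * (x - 1 / 2)) =
      rieszPartial n k x * f x - (f 1 - f 0) * (rieszPartial n k x * (x - 1 / 2)) := fun x => by ring
  simp_rw [e2]
  rw [integral_sub (hint f hf) ((hint _ (by fun_prop)).const_mul _), integral_const_mul,
    integral_rieszPartial_mul_sub_half]
  simp

theorem integral_rieszPartialMeasure {E : Type*} [NormedAddCommGroup E] [NormedSpace ℝ E]
    (n : ℕ → ℕ) (k : ℕ) (f : ℝ → E) :
    ∫ x, f x ∂(rieszPartialMeasure n k : Measure ℝ) = ∫ x, rieszPartial n k x • f x ∂unitVol := by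
  have h := integral_withDensity_eq_integral_toReal_smul (μ := unitVol)
    (f := fun x => ENNReal.ofReal (rieszPartial n k x))
    (continuous_rieszPartial n k).measurable.ennreal_ofReal (ae_of_all _ fun x => by simp) f
  simp only [ENNReal.toReal_ofReal (rieszPartial_nonneg n k _)] at h
  exact h

/-- The measures `p_k dx` lie in a compact set of measures on `[0,1]`, and the convergence of all
integrals of continuous functions leaves room for one cluster point only. -/
theorem tendsto_rieszPartialMeasure {n : ℕ → ℕ} (hpos : ∀ m, 0 < n m)
    (hg : ∀ m, 4 * n m ≤ n (m + 1)) :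
    Tendsto (rieszPartialMeasure n) atTop (𝓝 (rieszMeasure n)) := by
  refine tendsto_nhds_limUnder ?_
  have hmass : ∀ k, (rieszPartialMeasure n k).mass = 1 := by
    intro k
    have h1 := integral_rieszPartialMeasure n k (fun _ => (1 : ℝ))
    simp only [integral_const, smul_eq_mul, mul_one,
      integral_rieszPartial_unitVol hpos hg] at h1
    have h2 : ((rieszPartialMeasure n k).mass : ℝ) = 1 := h1
    exact_mod_cast h2
  have hsupp : ∀ k, rieszPartialMeasure n k (Set.Icc (0 : ℝ) 1)ᶜ = 0 := by
    intro k
    rw [FiniteMeasure.null_iff_toMeasure_null]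
    refine withDensity_absolutelyContinuous _ _ ?_
    rw [Measure.restrict_apply measurableSet_Icc.compl]
    simp
  have hK := isCompact_setOfPred_finiteMeasure_mass_eq_compl_isCompact_le (E := ℝ)
    (u := fun _ => 0) (K := fun _ => Set.Icc (0 : ℝ) 1) 1 tendsto_const_nhds
    (fun _ => isCompact_Icc) (Or.inl inferInstance)
  obtain ⟨P, -, hP⟩ := hK.exists_mapClusterPt (f := atTop) (u := rieszPartialMeasure n)
    (le_principal_iff.2 (mem_map.2 (Eventually.of_forall fun k =>
      ⟨hmass k, fun _ => (hsupp k).le⟩)))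
  refine ⟨P, FiniteMeasure.tendsto_iff_forall_integral_tendsto.2 fun f => ?_⟩
  obtain ⟨L, hL⟩ := exists_tendsto_integral_rieszPartial hpos hg f.continuous
  have hL' : Tendsto (fun k => ∫ x, f x ∂(rieszPartialMeasure n k : Measure ℝ)) atTop (𝓝 L) := by
    simpa only [integral_rieszPartialMeasure, smul_eq_mul] using hL
  have hcont : Continuous fun μ : FiniteMeasure ℝ => ∫ x, f x ∂(μ : Measure ℝ) :=
    FiniteMeasure.continuous_integral_boundedContinuousFunction f
  have hcl := hP.continuousAt_comp hcont.continuousAt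
  have : ∫ x, f x ∂(P : Measure ℝ) = L := by
    obtain ⟨ψ, hψ, hψ2⟩ := hcl.tendsto_subseq
    exact tendsto_nhds_unique hψ2 (hL'.comp hψ.tendsto_atTop)
  rwa [this]

/-! ### The Fejér density -/

section

open FourierTransform

theorem fejerDensity_nonneg (t : ℝ) : 0 ≤ fejerDensity t := by
  unfold fejerDensity
  split_ifs
  · positivity
  · have := Real.cos_le_one (2 * Real.pi * t)
    exact div_nonneg (by linarith) (sq_nonneg t)

theorem fejerDensity_le (t : ℝ) : fejerDensity t ≤ (2 * Real.pi ^ 2 + 2) * (1 + t ^ 2)⁻¹ := by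
  have hpi := Real.pi_pos
  rw [← div_eq_mul_inv, le_div_iff₀ (by positivity)]
  unfold fejerDensity
  split_ifs with h
  · rw [h]
    norm_num
  · have h1 := Real.one_sub_sq_div_two_le_cos (x := 2 * Real.pi * t)
    have h2 := Real.neg_one_le_cos (2 * Real.pi * t)
    have ht : 0 < t ^ 2 := by positivity
    rw [div_mul_eq_mul_div, div_le_iff₀ ht]
    nlinarith

/-- The triangle function `max (1 - |ξ|) 0`. -/
noncomputable def triangle (ξ : ℝ) : ℂ := ((max (1 - |ξ|) 0 : ℝ) : ℂ)

theorem continuous_triangle : Continuous triangle := by unfold triangle; fun_prop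

theorem triangle_eq_zero {ξ : ℝ} (h : 1 ≤ |ξ|) : triangle ξ = 0 := by
  simp [triangle, h]

theorem integrable_triangle : Integrable triangle := by
  refine continuous_triangle.integrable_of_hasCompactSupport
    (HasCompactSupport.intro (isCompact_Icc (a := -1) (b := 1)) fun ξ hξ => triangle_eq_zero ?_)
  by_contra h
  exact hξ (abs_le.1 (not_le.1 h).le)

theorem integral_one_sub_mul_exp {a : ℂ} (ha : a ≠ 0) :
    ∫ v in (0 : ℝ)..1, Complex.exp (a * v) * (1 - v) = (Complex.exp a - 1 - a) / a ^ 2 := by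
  have hd : ∀ x : ℝ, HasDerivAt
      (fun v : ℝ => Complex.exp (a * v) * ((1 - v) / a + 1 / a ^ 2))
      (Complex.exp (a * x) * (1 - x)) x := by
    intro x
    have h1 : HasDerivAt (fun v : ℝ => (v : ℂ)) 1 x := Complex.ofRealCLM.hasDerivAt
    have h2 := (h1.const_mul a).cexp
    have h3 := ((h1.const_sub 1).div_const a).add_const (1 / a ^ 2)
    refine (h2.fun_mul h3).congr_deriv ?_
    field_simp
    ring
  rw [intervalIntegral.integral_eq_sub_of_hasDerivAt (fun x _ => hd x)
    (Continuous.intervalIntegrable (by fun_prop) _ _)]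
  push_cast
  simp only [mul_one, mul_zero, Complex.exp_zero]
  field_simp
  ring

theorem integral_one_add_mul_exp {a : ℂ} (ha : a ≠ 0) :
    ∫ v in (-1 : ℝ)..0, Complex.exp (a * v) * (1 + v) = (Complex.exp (-a) - 1 + a) / a ^ 2 := by
  have h := intervalIntegral.integral_comp_neg (a := 0) (b := 1)
    (fun v : ℝ => Complex.exp (a * v) * (1 + v))
  rw [neg_zero] at h
  rw [← h]
  have h2 := integral_one_sub_mul_exp (neg_ne_zero.2 ha)
  rw [neg_sq, sub_neg_eq_add] at h2
  rw [← h2]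
  refine intervalIntegral.integral_congr fun x _ => ?_
  push_cast
  ring_nf

theorem fourier_triangle_eq_add (t : ℝ) :
    𝓕 triangle t = (∫ v in (-1 : ℝ)..0, fourierExp (-(v * t)) * (1 + v)) +
      ∫ v in (0 : ℝ)..1, fourierExp (-(v * t)) * (1 - v) := by
  have hc : Continuous fun v => fourierExp (-(v * t)) * triangle v :=
    (continuous_fourierExp.comp (by fun_prop)).mul continuous_triangle
  have h1 : 𝓕 triangle t = ∫ v in (-1 : ℝ)..1, fourierExp (-(v * t)) * triangle v := by
    rw [Real.fourier_real_eq, intervalIntegral.integral_of_le (by norm_num),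
      setIntegral_eq_integral_of_forall_compl_eq_zero]
    · simp only [fourierChar_smul]
    · intro x hx
      rw [triangle_eq_zero, mul_zero]
      rw [Set.mem_Ioc, not_and_or, not_lt, not_le] at hx
      rw [le_abs]
      rcases hx with hx | hx
      · right; linarith
      · left; linarith
  rw [h1, ← intervalIntegral.integral_add_adjacent_intervals (b := 0)
    (hc.intervalIntegrable _ _) (hc.intervalIntegrable _ _)]
  congr 1
  · refine intervalIntegral.integral_congr fun x hx => ?_
    rw [Set.uIcc_of_le (by norm_num)] at hx
    simp only [triangle]
    rw [abs_of_nonpos hx.2, max_eq_left (by linarith [hx.1])]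
    push_cast
    ring
  · refine intervalIntegral.integral_congr fun x hx => ?_
    rw [Set.uIcc_of_le (by norm_num)] at hx
    simp only [triangle]
    rw [abs_of_nonneg hx.1, max_eq_left (by linarith [hx.2])]
    push_cast
    ring

theorem fourier_triangle (t : ℝ) :
    𝓕 triangle t = ((fejerDensity t / (2 * Real.pi ^ 2) : ℝ) : ℂ) := by
  rw [fourier_triangle_eq_add]
  have hpi := Real.pi_ne_zero
  rcases eq_or_ne t 0 with rfl | ht
  · have h1 : ∫ v in (-1 : ℝ)..0, (1 + v : ℝ) = 1 / 2 := by
      rw [intervalIntegral.integral_add (by simp) (by simp)]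
      norm_num
    have h2 : ∫ v in (0 : ℝ)..1, (1 - v : ℝ) = 1 / 2 := by
      rw [intervalIntegral.integral_sub (by simp) (by simp)]
      norm_num
    have h3 : ∫ v in (-1 : ℝ)..0, fourierExp (-(v * 0)) * (1 + v) = ((1 / 2 : ℝ) : ℂ) := by
      rw [← h1, ← intervalIntegral.integral_ofReal]
      refine intervalIntegral.integral_congr fun v _ => ?_
      simp [fourierExp]
    have h4 : ∫ v in (0 : ℝ)..1, fourierExp (-(v * 0)) * (1 - v) = ((1 / 2 : ℝ) : ℂ) := by
      rw [← h2, ← intervalIntegral.integral_ofReal]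
      refine intervalIntegral.integral_congr fun v _ => ?_
      simp [fourierExp]
    rw [h3, h4, fejerDensity, if_pos rfl, div_self (by positivity)]
    norm_num
  · set a : ℂ := -(2 * Real.pi * t) * Complex.I with ha
    have ha0 : a ≠ 0 := by simp [ha, ht, hpi]
    have he : ∀ v : ℝ, fourierExp (-(v * t)) = Complex.exp (a * v) := by
      intro v
      rw [fourierExp, ha]
      push_cast
      ring_nf
    simp_rw [he]
    rw [integral_one_add_mul_exp ha0, integral_one_sub_mul_exp ha0, fejerDensity, if_neg ht]
    have ha2 : a ^ 2 = -(4 * Real.pi ^ 2 * t ^ 2) := by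
      rw [ha, mul_pow, Complex.I_sq]
      ring
    have hcos : Complex.exp a + Complex.exp (-a) = 2 * Complex.cos (2 * Real.pi * t) := by
      rw [Complex.cos, ha]
      ring_nf
    rw [← add_div, show Complex.exp (-a) - 1 + a + (Complex.exp a - 1 - a) =
      Complex.exp a + Complex.exp (-a) - 2 by ring, hcos, ha2]
    push_cast
    have : (t : ℂ) ≠ 0 := by exact_mod_cast ht
    have : (Real.pi : ℂ) ≠ 0 := by exact_mod_cast hpi
    field_simp
    ring

theorem continuous_fejerDensity : Continuous fejerDensity := by
  have h1 : Continuous (𝓕 triangle) :=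
    VectorFourier.fourierIntegral_continuous Real.continuous_fourierChar
      (by simp only [innerₗ_apply_apply]; fun_prop) integrable_triangle
  have h2 : fejerDensity = fun t => (2 * Real.pi ^ 2) * (𝓕 triangle t).re := by
    ext t
    rw [fourier_triangle, Complex.ofReal_re]
    have := Real.pi_ne_zero
    field_simp
  rw [h2]
  fun_prop

theorem integrable_fejerDensity : Integrable fejerDensity := by
  refine (integrable_inv_one_add_sq.const_mul (2 * Real.pi ^ 2 + 2)).mono'
    continuous_fejerDensity.aestronglyMeasurable (ae_of_all _ fun t => ?_)
  rw [Real.norm_of_nonneg (fejerDensity_nonneg t)]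
  exact fejerDensity_le t

/-- The Fourier transform of the Fejér density is `2π²` times the triangle function, by Fourier
inversion. -/
theorem integral_fejerDensity_mul_fourierExp (ξ : ℝ) :
    ∫ x, (fejerDensity x : ℂ) * fourierExp (-(x * ξ)) = 2 * Real.pi ^ 2 * triangle ξ := by
  have hF : 𝓕 triangle = fun t => ((fejerDensity t / (2 * Real.pi ^ 2) : ℝ) : ℂ) :=
    funext fourier_triangle
  have h := continuous_triangle.fourierInv_fourier_eq integrable_triangle
    (by rw [hF]; exact (integrable_fejerDensity.div_const _).ofReal)
  have h2 := congrFun h (-ξ)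
  have h3 : triangle (-ξ) = triangle ξ := by simp [triangle]
  rw [h3, Real.fourierInv_eq, hF] at h2
  rw [← h2, ← integral_const_mul]
  refine integral_congr_ae (ae_of_all _ fun x => ?_)
  have : (Real.pi : ℂ) ≠ 0 := by exact_mod_cast Real.pi_ne_zero
  simp only [fourierChar_smul, Real.inner_apply, mul_neg]
  push_cast
  field_simp

end

/-! ### Periodization -/

theorem inv_one_add_sq_add_int_le {x : ℝ} (hx : x ∈ Set.Icc (0 : ℝ) 1) (j : ℤ) :
    (1 + (x + j) ^ 2)⁻¹ ≤ 3 * (1 + (j : ℝ) ^ 2)⁻¹ := by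
  rw [← div_eq_mul_inv, inv_eq_one_div, div_le_div_iff₀ (by positivity) (by positivity)]
  nlinarith [hx.1, hx.2, sq_nonneg (2 * x + j), mul_nonneg hx.1 (sub_nonneg.2 hx.2)]

theorem summable_inv_one_add_sq_int : Summable fun j : ℤ => (1 + (j : ℝ) ^ 2)⁻¹ := by
  have h := (Real.summable_one_div_int_add_rpow (1 / 2) 2).2 one_lt_two
  refine (h.mul_left 2).of_nonneg_of_le (fun j => by positivity) fun j => ?_
  have hj : (j : ℝ) + 1 / 2 ≠ 0 := by
    intro h0
    have h2 : ((2 * j + 1 : ℤ) : ℝ) = 0 := by push_cast; linarith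
    have h3 : 2 * j + 1 = 0 := by exact_mod_cast h2
    omega
  have hj2 : 0 < ((j : ℝ) + 1 / 2) ^ 2 := by positivity
  rw [Real.rpow_two, sq_abs, mul_one_div, inv_eq_one_div, div_le_div_iff₀ (by positivity) hj2]
  nlinarith [sq_nonneg ((j : ℝ) - 1 / 2)]

theorem tendsto_integral_rieszMeasure {n : ℕ → ℕ} (hpos : ∀ m, 0 < n m)
    (hg : ∀ m, 4 * n m ≤ n (m + 1)) {E : Type*} [RCLike E] {f : ℝ → E} (hf : Continuous f) {C : ℝ}
    (hC : ∀ x, ‖f x‖ ≤ C) :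
    Tendsto (fun k => ∫ x, rieszPartial n k x • f x ∂unitVol) atTop
      (𝓝 (∫ x, f x ∂(rieszMeasure n : Measure ℝ))) := by
  have h := (FiniteMeasure.tendsto_iff_forall_integral_rclike_tendsto E).1
    (tendsto_rieszPartialMeasure hpos hg)
    (BoundedContinuousFunction.ofNormedAddCommGroup f hf C hC)
  simpa only [integral_rieszPartialMeasure, BoundedContinuousFunction.coe_ofNormedAddCommGroup]
    using h

theorem norm_integral_rieszPartial_smul_le {n : ℕ → ℕ} (hpos : ∀ m, 0 < n m)
    (hg : ∀ m, 4 * n m ≤ n (m + 1)) (k : ℕ) {E : Type*} [NormedAddCommGroup E] [NormedSpace ℝ E]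
    {f : ℝ → E} {C : ℝ} (hC : ∀ x ∈ Set.Icc (0 : ℝ) 1, ‖f x‖ ≤ C) :
    ‖∫ x, rieszPartial n k x • f x ∂unitVol‖ ≤ C := by
  have hpi : Integrable (rieszPartial n k) unitVol :=
    (continuous_rieszPartial n k).continuousOn.integrableOn_compact isCompact_Icc
  calc _ ≤ ∫ x, rieszPartial n k x * C ∂unitVol := by
        refine norm_integral_le_of_norm_le (hpi.mul_const _) ?_
        filter_upwards [ae_restrict_mem measurableSet_Icc] with x hx
        rw [norm_smul, Real.norm_of_nonneg (rieszPartial_nonneg n k x)]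
        exact mul_le_mul_of_nonneg_left (hC x hx) (rieszPartial_nonneg n k x)
    _ = C := by rw [integral_mul_const, integral_rieszPartial_unitVol hpos hg, one_mul]

/-- The bound is inherited from the densities `p_k` by weak convergence, so that it is not necessary
to know the support of the limit. -/
theorem integral_norm_comp_add_int_le {n : ℕ → ℕ} (hpos : ∀ m, 0 < n m)
    (hg : ∀ m, 4 * n m ≤ n (m + 1)) {f : ℝ → ℂ} (hf : Continuous f) {C : ℝ}
    (hC : ∀ x, ‖f x‖ ≤ C * (1 + x ^ 2)⁻¹) (j : ℤ) :
    ∫ x, ‖f (x + j)‖ ∂(rieszMeasure n : Measure ℝ) ≤ C * (3 * (1 + (j : ℝ) ^ 2)⁻¹) := by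
  have hC0 : 0 ≤ C := by simpa using (norm_nonneg _).trans (hC 0)
  have h := tendsto_integral_rieszMeasure hpos hg (E := ℝ) (f := fun x => ‖f (x + j)‖)
    (by fun_prop) (C := C) fun x => by
      rw [norm_norm]
      exact (hC _).trans (mul_le_of_le_one_right hC0 (inv_le_one_of_one_le₀ (by nlinarith)))
  refine le_of_tendsto h (Eventually.of_forall fun k => (le_abs_self _).trans ?_)
  refine norm_integral_rieszPartial_smul_le hpos hg k (f := fun x => ‖f (x + j)‖) fun x hx => ?_
  rw [norm_norm]
  exact (hC _).trans (mul_le_mul_of_nonneg_left (inv_one_add_sq_add_int_le hx j) hC0)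

theorem integrable_periodize_rieszMeasure {n : ℕ → ℕ} (hpos : ∀ m, 0 < n m)
    (hg : ∀ m, 4 * n m ≤ n (m + 1)) {f : ℝ → ℂ} (hf : Continuous f) {C : ℝ}
    (hC : ∀ x, ‖f x‖ ≤ C * (1 + x ^ 2)⁻¹) :
    Integrable f (periodize (rieszMeasure n : Measure ℝ)) := by
  refine ⟨hf.aestronglyMeasurable, ?_⟩
  have hC0 : 0 ≤ C := by simpa using (norm_nonneg _).trans (hC 0)
  rw [hasFiniteIntegral_iff_enorm, periodize, lintegral_sum_measure]
  have hi : ∀ j : ℤ, Integrable (fun x => ‖f (x + j)‖) (rieszMeasure n : Measure ℝ) := by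
    intro j
    refine (integrable_const C).mono' (Continuous.aestronglyMeasurable (by fun_prop))
      (ae_of_all _ fun x => ?_)
    rw [norm_norm]
    exact (hC _).trans (mul_le_of_le_one_right hC0 (inv_le_one_of_one_le₀ (by nlinarith)))
  have hj : ∀ j : ℤ, ∫⁻ x, ‖f x‖ₑ ∂((rieszMeasure n : Measure ℝ).map fun x => x + (j : ℝ)) ≤
      ENNReal.ofReal (C * (3 * (1 + (j : ℝ) ^ 2)⁻¹)) := by
    intro j
    rw [lintegral_map hf.measurable.enorm (by fun_prop)]
    simp_rw [← ofReal_norm]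
    rw [← ofReal_integral_eq_lintegral_ofReal (hi j) (ae_of_all _ fun x => norm_nonneg _)]
    exact ENNReal.ofReal_le_ofReal (integral_norm_comp_add_int_le hpos hg hf hC j)
  exact (ENNReal.tsum_le_tsum hj).trans_lt
    (((summable_inv_one_add_sq_int.mul_left 3).mul_left C).tsum_ofReal_lt_top)

/-- Integrals against the periodized Riesz product are limits of those against the periodic
densities `p_k`. -/
theorem tendsto_integral_periodize {n : ℕ → ℕ} (hpos : ∀ m, 0 < n m)
    (hg : ∀ m, 4 * n m ≤ n (m + 1)) {f : ℝ → ℂ} (hf : Continuous f) {C : ℝ}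
    (hC : ∀ x, ‖f x‖ ≤ C * (1 + x ^ 2)⁻¹) :
    Tendsto (fun k => ∫ x, (rieszPartial n k x : ℂ) * f x) atTop
      (𝓝 (∫ x, f x ∂periodize (rieszMeasure n : Measure ℝ))) := by
  have hC0 : 0 ≤ C := by simpa using (norm_nonneg _).trans (hC 0)
  have hfi : Integrable f := (integrable_inv_one_add_sq.const_mul C).mono'
    hf.aestronglyMeasurable (ae_of_all _ hC)
  have e1 : ∫ x, f x ∂periodize (rieszMeasure n : Measure ℝ) =
      ∑' j : ℤ, ∫ x, f (x + j) ∂(rieszMeasure n : Measure ℝ) := by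
    have h := integrable_periodize_rieszMeasure hpos hg hf hC
    rw [periodize] at h ⊢
    rw [integral_sum_measure h]
    exact tsum_congr fun j => integral_map (by fun_prop) hf.aestronglyMeasurable
  have e2 : ∀ k, ∫ x, (rieszPartial n k x : ℂ) * f x =
      ∑' j : ℤ, ∫ x, rieszPartial n k x • f (x + j) ∂unitVol := by
    intro k
    rw [← (integrable_rieszPartial_mul n volume k hfi).hasSum_intervalIntegral_comp_add_int.tsum_eq]
    refine tsum_congr fun j => ?_
    rw [intervalIntegral.integral_of_le zero_le_one, integral_Icc_eq_integral_Ioc]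
    simp only [rieszPartial_add_int, Complex.real_smul]
  rw [e1]
  simp_rw [e2]
  refine tendsto_tsum_of_dominated_convergence
    ((summable_inv_one_add_sq_int.mul_left 3).mul_left C) (fun j => ?_)
    (Eventually.of_forall fun k j => ?_)
  · refine tendsto_integral_rieszMeasure hpos hg (by fun_prop) (C := C) fun x => ?_
    exact (hC _).trans (mul_le_of_le_one_right hC0 (inv_le_one_of_one_le₀ (by nlinarith)))
  · refine norm_integral_rieszPartial_smul_le hpos hg k fun x hx => ?_
    exact (hC _).trans (mul_le_mul_of_nonneg_left (inv_one_add_sq_add_int_le hx j) hC0)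

/-! ### The Fourier transform of `ν` -/

/-- The measure `φ dx`, with `φ` the Fejér density. -/
noncomputable def fejerMeasure : Measure ℝ :=
  volume.withDensity fun t => ENNReal.ofReal (fejerDensity t)

instance : IsFiniteMeasure fejerMeasure :=
  isFiniteMeasure_withDensity_ofReal integrable_fejerDensity.2

theorem integral_fejerMeasure (f : ℝ → ℂ) :
    ∫ x, f x ∂fejerMeasure = ∫ x, f x * fejerDensity x := by
  rw [fejerMeasure, integral_withDensity_eq_integral_toReal_smul
    continuous_fejerDensity.measurable.ennreal_ofReal (ae_of_all _ fun x => by simp)]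
  refine integral_congr_ae (ae_of_all _ fun x => ?_)
  simp only [ENNReal.toReal_ofReal (fejerDensity_nonneg x), Complex.real_smul]
  ring

/-- The unnormalized measure `ν`. -/
noncomputable def rieszFejer (n : ℕ → ℕ) : Measure ℝ :=
  (periodize (rieszMeasure n : Measure ℝ)).withDensity
    (fun t => ENNReal.ofReal (fejerDensity t))

/-- The low-frequency part `p_1 φ dx` of the unnormalized `ν`. The first factor of the Riesz product
is included since, if `n 0 = 1`, the frequencies it contributes spill out of the cloud interval. -/
noncomputable def rieszFejerLow (n : ℕ → ℕ) : Measure ℝ :=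
  fejerMeasure.withDensity (fun t => ENNReal.ofReal (rieszPartial n 1 t))

theorem rieszFourier_fejerMeasure_zero (n : ℕ → ℕ) (ξ : ℝ) :
    rieszFourier n fejerMeasure 0 ξ = 2 * Real.pi ^ 2 * triangle ξ := by
  rw [← integral_fejerDensity_mul_fourierExp, rieszFourier, integral_fejerMeasure]
  refine integral_congr_ae (ae_of_all _ fun x => ?_)
  simp [rieszPartial, mul_comm]

theorem fourierMeas_rieszFejerLow (n : ℕ → ℕ) (ξ : ℝ) :
    fourierMeas (rieszFejerLow n) ξ = rieszFourier n fejerMeasure 1 ξ := by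
  rw [fourierMeas, rieszFejerLow, integral_withDensity_eq_integral_toReal_smul
    (continuous_rieszPartial n 1).measurable.ennreal_ofReal (ae_of_all _ fun x => by simp)]
  refine integral_congr_ae (ae_of_all _ fun x => ?_)
  simp only [ENNReal.toReal_ofReal (rieszPartial_nonneg n 1 x), Complex.real_smul]

theorem tendsto_rieszFourier_fejerMeasure {n : ℕ → ℕ} (hpos : ∀ m, 0 < n m)
    (hg : ∀ m, 4 * n m ≤ n (m + 1)) (ξ : ℝ) :
    Tendsto (fun k => rieszFourier n fejerMeasure k ξ) atTop
      (𝓝 (fourierMeas (rieszFejer n) ξ)) := by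
  have hc := continuous_fejerDensity
  have h := tendsto_integral_periodize hpos hg
    (f := fun x => (fejerDensity x : ℂ) * fourierExp (-(x * ξ))) (by fun_prop)
    (C := 2 * Real.pi ^ 2 + 2) fun x => by
      rw [norm_mul, norm_fourierExp, mul_one, Complex.norm_real,
        Real.norm_of_nonneg (fejerDensity_nonneg x)]
      exact fejerDensity_le x
  have e1 : fourierMeas (rieszFejer n) ξ = ∫ x, (fejerDensity x : ℂ) * fourierExp (-(x * ξ))
      ∂periodize (rieszMeasure n : Measure ℝ) := by
    rw [fourierMeas, rieszFejer, integral_withDensity_eq_integral_toReal_smul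
      continuous_fejerDensity.measurable.ennreal_ofReal (ae_of_all _ fun x => by simp)]
    refine integral_congr_ae (ae_of_all _ fun x => ?_)
    simp only [ENNReal.toReal_ofReal (fejerDensity_nonneg x), Complex.real_smul]
  rw [e1]
  refine h.congr fun k => ?_
  rw [rieszFourier, integral_fejerMeasure]
  refine integral_congr_ae (ae_of_all _ fun x => ?_)
  simp only
  ring

theorem rieszFourier_fejerMeasure_eq_zero (n : ℕ → ℕ) :
    ∀ ξ ∈ (⊤ : AddSubgroup ℝ), 1 ≤ |ξ| → rieszFourier n fejerMeasure 0 ξ = 0 := fun ξ _ hξ => by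
  rw [rieszFourier_fejerMeasure_zero, triangle_eq_zero hξ, mul_zero]

/-- The Fourier transform of `φ p_k cos(2π n_k x)` lives within `freqSum n k + 1` of `± n_k`, which is
inside the `k`-th cloud interval. This fails for `k = 0` if `n 0 = 1`. -/
theorem freqSum_add_one_le {n : ℕ → ℕ} (hpos : ∀ m, 0 < n m) (hg : ∀ m, 4 * n m ≤ n (m + 1))
    {m : ℕ} (hm : 1 ≤ m) : 2 * (freqSum n m + 1) ≤ n m := by
  obtain ⟨m, rfl⟩ := Nat.exists_eq_add_of_le' hm
  have h1 := three_mul_freqSum_lt hpos hg (m + 1)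
  have h2 := hg m
  have h3 := hpos m
  have h4 := freqSum_succ n m
  omega

/-- Outside of the clouds, the Fourier transform of `ν` is that of its low-frequency part. -/
theorem fourierMeas_rieszFejer_eq {n : ℕ → ℕ} (hpos : ∀ m, 0 < n m)
    (hg : ∀ m, 4 * n m ≤ n (m + 1)) {ξ : ℝ} (hξ : ∀ m, |ξ| ∉ cloud n m) :
    fourierMeas (rieszFejer n) ξ = fourierMeas (rieszFejerLow n) ξ := by
  rw [fourierMeas_rieszFejerLow]
  refine tendsto_nhds_unique (tendsto_rieszFourier_fejerMeasure hpos hg ξ)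
    (tendsto_const_nhds.congr' ?_)
  filter_upwards [eventually_ge_atTop 1] with k hk
  induction k, hk using Nat.le_induction with
  | base => rfl
  | succ k hk ih =>
    rw [ih, rieszFourier_succ_eq (T := ⊤) (fun _ => trivial) (rieszFourier_fejerMeasure_eq_zero n)
      k trivial]
    have h1 : (2 * (freqSum n k + 1) : ℝ) ≤ n k := by
      exact_mod_cast freqSum_add_one_le hpos hg hk
    by_contra hcon
    rw [not_le, abs_lt] at hcon
    exact hξ k ⟨by linarith, by linarith⟩

instance (n : ℕ → ℕ) : IsFiniteMeasure (rieszFejerLow n) := by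
  refine isFiniteMeasure_withDensity_ofReal ?_
  have h := integrable_rieszPartial_mul n fejerMeasure 1 (integrable_const (1 : ℂ))
  simp only [mul_one] at h
  exact h.re.2

theorem isFiniteMeasure_rieszFejer {n : ℕ → ℕ} (hpos : ∀ m, 0 < n m)
    (hg : ∀ m, 4 * n m ≤ n (m + 1)) : IsFiniteMeasure (rieszFejer n) := by
  have hc := continuous_fejerDensity
  have h := integrable_periodize_rieszMeasure hpos hg (f := fun x => (fejerDensity x : ℂ))
    (by fun_prop) (C := 2 * Real.pi ^ 2 + 2) fun x => by
      rw [Complex.norm_real, Real.norm_of_nonneg (fejerDensity_nonneg x)]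
      exact fejerDensity_le x
  exact isFiniteMeasure_withDensity_ofReal h.re.2

theorem fourierMeas_zero (η : Measure ℝ) : fourierMeas η 0 = η.real Set.univ := by
  simp [fourierMeas, fourierExp]

theorem real_rieszFejerLow_univ {n : ℕ → ℕ} (hpos : ∀ m, 0 < n m) :
    (rieszFejerLow n).real Set.univ = 2 * Real.pi ^ 2 := by
  have h := fourierMeas_rieszFejerLow n 0
  rw [fourierMeas_zero, ← zero_add 1, rieszFourier_succ_eq (T := ⊤) (fun _ => trivial)
    (rieszFourier_fejerMeasure_eq_zero n) 0 trivial, rieszFourier_fejerMeasure_zero] at h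
  · have h2 : triangle 0 = 1 := by simp [triangle]
    rw [h2, mul_one] at h
    exact_mod_cast h
  · have : (1 : ℝ) ≤ n 0 := by exact_mod_cast hpos 0
    simpa [freqSum] using this

theorem real_rieszFejer_univ {n : ℕ → ℕ} (hpos : ∀ m, 0 < n m)
    (hg : ∀ m, 4 * n m ≤ n (m + 1)) : (rieszFejer n).real Set.univ = 2 * Real.pi ^ 2 := by
  have h := fourierMeas_rieszFejer_eq hpos hg (ξ := 0) fun m hm => by
    have h1 : (0 : ℝ) < n m := by exact_mod_cast hpos m
    have h2 := hm.1
    rw [abs_zero] at h2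
    linarith
  rw [fourierMeas_zero, fourierMeas_zero, real_rieszFejerLow_univ hpos] at h
  exact_mod_cast h

/-- The constant `1 / (2π²)` normalizing `ν`. -/
noncomputable def fejerConst : ℝ≥0 := Real.toNNReal (2 * Real.pi ^ 2)⁻¹

theorem nuMeasure_eq {n : ℕ → ℕ} (hpos : ∀ m, 0 < n m) (hg : ∀ m, 4 * n m ≤ n (m + 1)) :
    nuMeasure n = fejerConst • rieszFejer n := by
  have := isFiniteMeasure_rieszFejer hpos hg
  have h : rieszFejer n Set.univ = ENNReal.ofReal (2 * Real.pi ^ 2) := by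
    rw [← real_rieszFejer_univ hpos hg, ofReal_measureReal]
  change (rieszFejer n Set.univ)⁻¹ • rieszFejer n = _
  rw [h, ← ENNReal.ofReal_inv_of_pos (by positivity)]
  rfl

/-- The low-frequency part of `ν`. -/
noncomputable def nuLow (n : ℕ → ℕ) : Measure ℝ := fejerConst • rieszFejerLow n

theorem fejerConst_mul : (fejerConst : ℝ) * (2 * Real.pi ^ 2) = 1 := by
  rw [fejerConst, Real.coe_toNNReal _ (by positivity)]
  exact inv_mul_cancel₀ (by positivity)

theorem isProbabilityMeasure_nuMeasure {n : ℕ → ℕ} (hpos : ∀ m, 0 < n m)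
    (hg : ∀ m, 4 * n m ≤ n (m + 1)) : IsProbabilityMeasure (nuMeasure n) := by
  have := isFiniteMeasure_rieszFejer hpos hg
  rw [nuMeasure_eq hpos hg, isProbabilityMeasure_iff_real, measureReal_nnreal_smul_apply,
    real_rieszFejer_univ hpos hg, fejerConst_mul]

theorem isProbabilityMeasure_nuLow {n : ℕ → ℕ} (hpos : ∀ m, 0 < n m) :
    IsProbabilityMeasure (nuLow n) := by
  rw [nuLow, isProbabilityMeasure_iff_real, measureReal_nnreal_smul_apply,
    real_rieszFejerLow_univ hpos, fejerConst_mul]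

theorem fourierMeas_smul (c : ℝ≥0) (η : Measure ℝ) (ξ : ℝ) :
    fourierMeas (c • η) ξ = c • fourierMeas η ξ := integral_smul_nnreal_measure _ _

theorem fourierMeas_nuMeasure_eq {n : ℕ → ℕ} (hpos : ∀ m, 0 < n m)
    (hg : ∀ m, 4 * n m ≤ n (m + 1)) {ξ : ℝ} (hξ : ∀ m, |ξ| ∉ cloud n m) :
    fourierMeas (nuMeasure n) ξ = fourierMeas (nuLow n) ξ := by
  rw [nuMeasure_eq hpos hg, nuLow, fourierMeas_smul, fourierMeas_smul,
    fourierMeas_rieszFejer_eq hpos hg hξ]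

/-! ### Contractions -/

theorem fourierMeas_contraction (t : ℝ) (η : Measure ℝ) (ξ : ℝ) :
    fourierMeas (contraction t η) ξ = fourierMeas η (t * ξ) := by
  rw [fourierMeas, contraction, integral_map (by fun_prop)
    (Continuous.aestronglyMeasurable (by fun_prop))]
  refine integral_congr_ae (ae_of_all _ fun x => ?_)
  simp only
  congr 1
  ring

theorem isProbabilityMeasure_contraction (t : ℝ) (η : Measure ℝ) [IsProbabilityMeasure η] :
    IsProbabilityMeasure (contraction t η) :=
  Measure.isProbabilityMeasure_map (by fun_prop)

/-- The low-frequency part is dominated by a Poisson kernel. -/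
theorem rieszFejerLow_le (n : ℕ → ℕ) :
    rieszFejerLow n ≤ ENNReal.ofReal (2 * (2 * Real.pi ^ 2 + 2)) •
      volume.withDensity (poissonKer 1) := by
  have hm1 : Measurable fun t => ENNReal.ofReal (fejerDensity t) :=
    continuous_fejerDensity.measurable.ennreal_ofReal
  have hm2 : Measurable fun t => ENNReal.ofReal (rieszPartial n 1 t) :=
    (continuous_rieszPartial n 1).measurable.ennreal_ofReal
  rw [rieszFejerLow, fejerMeasure, ← withDensity_mul _ hm1 hm2,
    ← withDensity_smul _ (measurable_poissonKer 1)]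
  refine withDensity_mono (ae_of_all _ fun x => ?_)
  simp only [Pi.mul_apply, Pi.smul_apply, smul_eq_mul, poissonKer]
  rw [← ENNReal.ofReal_mul (fejerDensity_nonneg x), ← ENNReal.ofReal_mul (by positivity)]
  refine ENNReal.ofReal_le_ofReal ?_
  have h1 := rieszPartial_le n 1 x
  have h2 := fejerDensity_le x
  calc _ ≤ (2 * Real.pi ^ 2 + 2) * (1 + x ^ 2)⁻¹ * 2 ^ 1 :=
        mul_le_mul h2 h1 (rieszPartial_nonneg n 1 x) (by positivity)
    _ = _ := by
        rw [one_pow, one_div]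
        ring

theorem lintegral_poissonKer_comp_mul {t : ℝ} (ht : 0 < t) {h : ℝ → ℝ≥0∞} (hh : Measurable h)
    (x : ℝ) : ∫⁻ y, poissonKer 1 y * h (x - t * y) = poissonInt t h x := by
  have m1 := measurable_poissonKer 1
  have m2 := measurable_poissonKer t
  have e : ∀ y, poissonKer 1 y * h (x - t * y) =
      (fun z => poissonKer 1 (z / t) * h (x - z)) (t * y) := fun y => by
    simp only
    rw [mul_div_cancel_left₀ _ ht.ne']
  simp_rw [e]
  rw [← lintegral_map (f := fun z => poissonKer 1 (z / t) * h (x - z)) (by fun_prop)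
    (measurable_const_mul t), Real.map_volume_mul_left ht.ne', lintegral_smul_measure, smul_eq_mul,
    ← lintegral_const_mul _ (by fun_prop), poissonInt, ← lintegral_sub_left_eq_self _ x]
  refine lintegral_congr fun z => ?_
  rw [← mul_assoc, poissonKer, poissonKer, ← ENNReal.ofReal_mul (by positivity)]
  congr 2
  · rw [abs_of_pos (by positivity)]
    field_simp
  · rw [sub_sub_cancel]

theorem lintegral_contraction_nuLow_le (n : ℕ → ℕ) : ∃ K : ℝ≥0, ∀ t > 0, ∀ h : ℝ → ℝ≥0∞,
    Measurable h → ∀ x, ∫⁻ y, h (x - y) ∂contraction t (nuLow n) ≤ K * poissonInt t h x := by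
  refine ⟨fejerConst * Real.toNNReal (2 * (2 * Real.pi ^ 2 + 2)), fun t ht h hh x => ?_⟩
  have m1 := measurable_poissonKer 1
  rw [contraction, lintegral_map (by fun_prop) (by fun_prop), nuLow, lintegral_smul_measure,
    ENNReal.coe_mul, mul_assoc]
  change (fejerConst : ℝ≥0∞) * _ ≤ _
  refine mul_le_mul_right ?_ _
  calc _ ≤ _ := lintegral_mono' (rieszFejerLow_le n) le_rfl
    _ = _ := by
      rw [lintegral_smul_measure, lintegral_withDensity_eq_lintegral_mul _ m1 (by fun_prop),
        ← lintegral_poissonKer_comp_mul ht hh]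
      rfl

/-! ### An explicit pair of sequences -/

theorem log_two_pow_add_two_pow {a b : ℕ} (h : a ≠ b) : Nat.log 2 (2 ^ a + 2 ^ b) = max a b := by
  wlog hab : a < b generalizing a b
  · rw [add_comm, max_comm]
    exact this h.symm (by omega)
  rw [max_eq_right hab.le]
  refine Nat.log_eq_of_pow_le_of_lt_pow (Nat.le_add_left _ _) ?_
  have : 2 ^ a < 2 ^ b := Nat.pow_lt_pow_right (by norm_num) hab
  rw [pow_succ]
  omega

theorem separatedClouds_two_pow : SeparatedClouds (fun m => 2 ^ 2 ^ (2 * (m + 1)))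
    (fun k => 1 / (2 : ℝ) ^ 2 ^ (2 * (k + 1) + 1)) where
  freq_pos m := by positivity
  growth m := by
    have h : 2 + 2 ^ (2 * (m + 1)) ≤ 2 ^ (2 * (m + 1 + 1)) := by
      rw [show 2 * (m + 1 + 1) = 2 * (m + 1) + 2 by ring, pow_add]
      have : 2 ^ 1 ≤ 2 ^ (2 * (m + 1)) := Nat.pow_le_pow_right (by norm_num) (by omega)
      omega
    calc 4 * 2 ^ 2 ^ (2 * (m + 1)) = 2 ^ (2 + 2 ^ (2 * (m + 1))) := by rw [pow_add]; norm_num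
      _ ≤ _ := Nat.pow_le_pow_right (by norm_num) h
  pos k := by positivity
  anti k l hkl := by
    have h : 2 ^ (2 * (k + 1) + 1) < 2 ^ (2 * (l + 1) + 1) :=
      Nat.pow_lt_pow_right (by norm_num) (by omega)
    exact one_div_lt_one_div_of_lt (by positivity) (pow_lt_pow_right₀ (by norm_num) h)
  tendsto_zero := by
    have h : Tendsto (fun k : ℕ => 2 ^ (2 * (k + 1) + 1)) atTop atTop :=
      tendsto_atTop_mono (fun k => (show k ≤ 2 * (k + 1) + 1 by omega).trans
        (Nat.lt_two_pow_self).le) tendsto_id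
    simp only [one_div]
    exact tendsto_inv_atTop_zero.comp
      ((tendsto_pow_atTop_atTop_of_one_lt (one_lt_two (α := ℝ))).comp h)
  separated s k l m m' h1 h2 := by
    simp only [cloud, Set.mem_Icc, Nat.cast_pow, Nat.cast_ofNat] at h1 h2
    -- `n_m / t_k` and `n_m' / t_l` are powers of two whose ratio lies in `[1/3, 3]`, so that their
    -- exponents differ by at most one
    have key : ∀ {a b c d : ℕ}, (2 : ℝ) ^ a / 2 ≤ 1 / 2 ^ b * s →
        1 / 2 ^ d * s ≤ 3 * 2 ^ c / 2 → a + b ≤ c + d + 1 := by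
      intro a b c d hab hcd
      by_contra hcon
      have hle : c + d + 2 ≤ a + b := by omega
      have h3 : (2 : ℝ) ^ (c + d + 2) ≤ 2 ^ (a + b) := pow_le_pow_right₀ (by norm_num) hle
      have hb : (0 : ℝ) < 2 ^ b := by positivity
      have hd : (0 : ℝ) < 2 ^ d := by positivity
      have hc : (0 : ℝ) < 2 ^ c := by positivity
      rw [one_div_mul_eq_div, le_div_iff₀ hb] at hab
      rw [one_div_mul_eq_div, div_le_iff₀ hd] at hcd
      rw [pow_add, pow_add, pow_add] at h3
      nlinarith [mul_pos hc hd]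
    have e1 := key h1.1 h2.2
    have e2 := key h2.1 h1.2
    -- all four exponents are multiples of `4`, so the two sums agree
    have h4 : ∀ i j : ℕ, 4 ∣ 2 ^ (2 * (i + 1) + j) := fun i j =>
      pow_dvd_pow 2 (show 2 ≤ 2 * (i + 1) + j by omega)
    have e : 2 ^ (2 * (m + 1)) + 2 ^ (2 * (k + 1) + 1) =
        2 ^ (2 * (m' + 1)) + 2 ^ (2 * (l + 1) + 1) := by
      have d1 := h4 m 0
      have d2 := h4 k 1
      have d3 := h4 m' 0
      have d4 := h4 l 1
      simp only [add_zero] at d1 d3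
      omega
    have hmax := congrArg (Nat.log 2) e
    rw [log_two_pow_add_two_pow (by omega), log_two_pow_add_two_pow (by omega)] at hmax
    -- the larger exponents agree; by parity they are both even or both odd
    rcases le_total (2 * (m + 1)) (2 * (k + 1) + 1) with h | h
    · rw [max_eq_right h] at hmax
      omega
    · rw [max_eq_left h] at hmax
      have hm : m = m' := by omega
      subst hm
      have := Nat.pow_right_injective le_rfl (Nat.add_left_cancel e)
      omega

/-! ### The maximal inequality for `ν` -/

/-- At each frequency at most one of the dilated Fourier transforms differs from its low-frequency
part. -/
theorem sum_enorm_sq_fourierMeas_sub_le {n : ℕ → ℕ} {t : ℕ → ℝ} (hs : SeparatedClouds n t)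
    (s : Finset ℕ) (ξ : ℝ) :
    ∑ k ∈ s, ‖fourierMeas (contraction (t k) (nuMeasure n)) ξ -
      fourierMeas (contraction (t k) (nuLow n)) ξ‖ₑ ^ 2 ≤ (4 : ℝ≥0) := by
  have := isProbabilityMeasure_nuMeasure hs.freq_pos hs.growth
  have := isProbabilityMeasure_nuLow hs.freq_pos
  simp only [fourierMeas_contraction]
  have hex : ∀ k, fourierMeas (nuMeasure n) (t k * ξ) - fourierMeas (nuLow n) (t k * ξ) ≠ 0 →
      ∃ m, t k * |ξ| ∈ cloud n m := by
    intro k hk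
    by_contra! hcon
    refine hk (sub_eq_zero.2 (fourierMeas_nuMeasure_eq hs.freq_pos hs.growth ?_))
    rwa [abs_mul, abs_of_pos (hs.pos k)]
  by_cases h : ∃ k ∈ s, fourierMeas (nuMeasure n) (t k * ξ) - fourierMeas (nuLow n) (t k * ξ) ≠ 0
  · obtain ⟨k, hks, hk⟩ := h
    obtain ⟨m, hm⟩ := hex k hk
    rw [Finset.sum_eq_single_of_mem k hks]
    · have h1 : ‖fourierMeas (nuMeasure n) (t k * ξ) - fourierMeas (nuLow n) (t k * ξ)‖ ≤ 2 := by
        refine (norm_sub_le _ _).trans ?_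
        have h2 := norm_fourierMeas_le (nuMeasure n) (t k * ξ)
        have h3 := norm_fourierMeas_le (nuLow n) (t k * ξ)
        simp only [probReal_univ] at h2 h3
        linarith
      rw [← ofReal_norm, ← ENNReal.ofReal_pow (norm_nonneg _)]
      refine (ENNReal.ofReal_le_ofReal (pow_le_pow_left₀ (norm_nonneg _) h1 2)).trans ?_
      norm_num
    · intro l _ hlk
      by_contra hl
      obtain ⟨m', hm'⟩ := hex l fun h0 => hl (by rw [h0]; simp)
      exact hlk (hs.separated |ξ| l k m' m hm' hm)
  · push Not at h
    rw [Finset.sum_eq_zero fun k hk => by rw [h k hk]; simp]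
    exact zero_le

/-- The square function of the high-frequency parts is bounded on `L²`. -/
theorem lintegral_tsum_enorm_sq_measConv_sub_le {n : ℕ → ℕ} {t : ℕ → ℝ} (hs : SeparatedClouds n t)
    {f : ℝ → ℂ} (hf : MemLp f 2 volume) :
    ∫⁻ x, ∑' k, ‖measConv (contraction (t k) (nuMeasure n)) f x -
      measConv (contraction (t k) (nuLow n)) f x‖ₑ ^ 2 ≤ 4 * eLpNorm f 2 volume ^ 2 := by
  have := isProbabilityMeasure_nuMeasure hs.freq_pos hs.growth
  have := isProbabilityMeasure_nuLow hs.freq_pos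
  have := fun k => isProbabilityMeasure_contraction (t k) (nuMeasure n)
  have := fun k => isProbabilityMeasure_contraction (t k) (nuLow n)
  rw [lintegral_tsum fun k => ((aestronglyMeasurable_measConv _ hf.1).fun_sub
    (aestronglyMeasurable_measConv _ hf.1)).enorm.pow_const 2]
  refine ENNReal.tsum_le_of_sum_range_le fun N => ?_
  have h := sum_eLpNorm_sq_measConv_sub_le (Finset.range N)
    (fun k => contraction (t k) (nuMeasure n)) (fun k => contraction (t k) (nuLow n))
    (sum_enorm_sq_fourierMeas_sub_le hs _) hf
  simp_rw [eLpNorm_two_sq] at h ⊢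
  exact h

/-- The maximal inequality for the low-frequency parts. -/
theorem exists_lintegral_sq_iSup_nuLow_le {n : ℕ → ℕ} {t : ℕ → ℝ} (hs : SeparatedClouds n t) :
    ∃ K : ℝ≥0, ∀ f : ℝ → ℂ, MemLp f 2 volume →
      ∫⁻ x, (⨆ k, ‖measConv (contraction (t k) (nuLow n)) f x‖ₑ) ^ 2
        ≤ K * eLpNorm f 2 volume ^ 2 := by
  have := isProbabilityMeasure_nuLow hs.freq_pos
  have := fun k => isProbabilityMeasure_contraction (t k) (nuLow n)
  obtain ⟨K, hK⟩ := lintegral_contraction_nuLow_le n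
  refine ⟨K ^ 2 * Real.toNNReal (8 * Real.pi) ^ 2, fun f hf => ?_⟩
  obtain ⟨g, hg, hfg⟩ := hf.1
  have hm : Measurable fun x => ‖g x‖ₑ := hg.measurable.enorm
  have hae : ∀ᵐ x, ∀ k, measConv (contraction (t k) (nuLow n)) f x =
      measConv (contraction (t k) (nuLow n)) g x :=
    ae_all_iff.2 fun k => measConv_congr _ hfg
  calc ∫⁻ x, (⨆ k, ‖measConv (contraction (t k) (nuLow n)) f x‖ₑ) ^ 2
      ≤ ∫⁻ x, (K : ℝ≥0∞) ^ 2 * (⨆ k, poissonInt (t k) (fun x => ‖g x‖ₑ) x) ^ 2 := by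
        refine lintegral_mono_ae ?_
        filter_upwards [hae] with x hx
        rw [← mul_pow, ENNReal.mul_iSup]
        refine pow_le_pow_left' (iSup_mono fun k => ?_) 2
        rw [hx k]
        exact (enorm_integral_le_lintegral_enorm _).trans (hK (t k) (hs.pos k) _ hm x)
    _ = (K : ℝ≥0∞) ^ 2 * ∫⁻ x, (⨆ k, poissonInt (t k) (fun x => ‖g x‖ₑ) x) ^ 2 :=
        lintegral_const_mul' _ _ (by finiteness)
    _ ≤ (K : ℝ≥0∞) ^ 2 * (ENNReal.ofReal (8 * Real.pi) ^ 2 * ∫⁻ x, ‖g x‖ₑ ^ 2) := by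
        gcongr
        exact lintegral_sq_iSup_poissonInt_le hs.pos hs.anti.antitone hm
    _ = _ := by
        rw [eLpNorm_congr_ae hfg, eLpNorm_two_sq, ← mul_assoc]
        push_cast
        rfl

theorem ENNReal.add_sq_le_four_mul (a b : ℝ≥0∞) : (a + b) ^ 2 ≤ 4 * (a ^ 2 + b ^ 2) := by
  rcases le_total a b with h | h
  · calc (a + b) ^ 2 ≤ (b + b) ^ 2 := by gcongr
      _ = 4 * b ^ 2 := by ring
      _ ≤ _ := by gcongr; exact le_add_self
  · calc (a + b) ^ 2 ≤ (a + a) ^ 2 := by gcongr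
      _ = 4 * a ^ 2 := by ring
      _ ≤ _ := by gcongr; exact le_self_add

theorem exists_eLpNorm_iSup_le {n : ℕ → ℕ} {t : ℕ → ℝ} (hs : SeparatedClouds n t) :
    ∃ C : ℝ≥0, ∀ f : ℝ → ℂ, MemLp f 2 volume →
      eLpNorm (fun x => ⨆ k, ‖measConv (contraction (t k) (nuMeasure n)) f x‖ₑ) 2 volume
        ≤ C * eLpNorm f 2 volume := by
  have := isProbabilityMeasure_nuMeasure hs.freq_pos hs.growth
  have := isProbabilityMeasure_nuLow hs.freq_pos
  have := fun k => isProbabilityMeasure_contraction (t k) (nuMeasure n)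
  have := fun k => isProbabilityMeasure_contraction (t k) (nuLow n)
  obtain ⟨K, hK⟩ := exists_lintegral_sq_iSup_nuLow_le hs
  refine ⟨NNReal.sqrt (4 * (K + 4)), fun f hf => ?_⟩
  rw [← ENNReal.pow_le_pow_left_iff two_ne_zero, mul_pow, eLpNorm_two_sq, ← ENNReal.coe_pow,
    NNReal.sq_sqrt]
  set D : ℝ → ℝ≥0∞ := fun x => ∑' k, ‖measConv (contraction (t k) (nuMeasure n)) f x -
      measConv (contraction (t k) (nuLow n)) f x‖ₑ ^ 2 with hD
  have hDm : AEMeasurable D := AEMeasurable.tsum fun k =>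
    ((aestronglyMeasurable_measConv _ hf.1).sub
      (aestronglyMeasurable_measConv _ hf.1)).enorm.pow_const 2
  have hpt : ∀ x, ‖⨆ k, ‖measConv (contraction (t k) (nuMeasure n)) f x‖ₑ‖ₑ ^ 2 ≤
      4 * ((⨆ k, ‖measConv (contraction (t k) (nuLow n)) f x‖ₑ) ^ 2 + D x) := by
    intro x
    set a := ⨆ k, ‖measConv (contraction (t k) (nuLow n)) f x‖ₑ with ha
    set b := ⨆ k, ‖measConv (contraction (t k) (nuMeasure n)) f x -
      measConv (contraction (t k) (nuLow n)) f x‖ₑ with hb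
    have h1 : ⨆ k, ‖measConv (contraction (t k) (nuMeasure n)) f x‖ₑ ≤ a + b := by
      refine iSup_le fun k => ?_
      calc _ = ‖measConv (contraction (t k) (nuLow n)) f x +
            (measConv (contraction (t k) (nuMeasure n)) f x -
              measConv (contraction (t k) (nuLow n)) f x)‖ₑ := by rw [add_sub_cancel]
        _ ≤ _ := enorm_add_le _ _
        _ ≤ a + b := add_le_add (le_iSup (fun k => ‖measConv (contraction (t k) (nuLow n)) f x‖ₑ) k)
            (le_iSup (fun k => ‖measConv (contraction (t k) (nuMeasure n)) f x -
              measConv (contraction (t k) (nuLow n)) f x‖ₑ) k)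
    have h2 : b ^ 2 ≤ D x := by
      rw [hb, Monotone.map_iSup_of_continuousAt (f := fun y : ℝ≥0∞ => y ^ 2)
        (ENNReal.continuous_pow 2).continuousAt (fun _ _ h => pow_le_pow_left' h 2) (by simp)]
      exact iSup_le fun k => ENNReal.le_tsum k
    rw [enorm_eq_self]
    calc _ ≤ (a + b) ^ 2 := pow_le_pow_left' h1 2
      _ ≤ 4 * (a ^ 2 + b ^ 2) := ENNReal.add_sq_le_four_mul a b
      _ ≤ _ := by gcongr
  calc _ ≤ ∫⁻ x, 4 * ((⨆ k, ‖measConv (contraction (t k) (nuLow n)) f x‖ₑ) ^ 2 + D x) :=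
        lintegral_mono hpt
    _ = 4 * ((∫⁻ x, (⨆ k, ‖measConv (contraction (t k) (nuLow n)) f x‖ₑ) ^ 2) + ∫⁻ x, D x) := by
        rw [lintegral_const_mul' _ _ (by finiteness), lintegral_add_right' _ hDm]
    _ ≤ 4 * (K * eLpNorm f 2 volume ^ 2 + 4 * eLpNorm f 2 volume ^ 2) := by
        gcongr
        · exact hK f hf
        · exact lintegral_tsum_enorm_sq_measConv_sub_le hs hf
    _ = _ := by
        push_cast
        ring

/-! ### Almost everywhere convergence -/

theorem tendsto_measConv_contraction {t : ℕ → ℝ} (ht : Tendsto t atTop (𝓝 0)) (η : Measure ℝ)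
    [IsProbabilityMeasure η] {g : ℝ → ℂ} (hg : Continuous g) (hgc : HasCompactSupport g) (x : ℝ) :
    Tendsto (fun k => measConv (contraction (t k) η) g x) atTop (𝓝 (g x)) := by
  obtain ⟨B, hB⟩ := hgc.exists_bound_of_continuous hg
  have e : ∀ k, measConv (contraction (t k) η) g x = ∫ y, g (x - t k * y) ∂η := fun k => by
    rw [measConv, contraction, integral_map (by fun_prop)
      (Continuous.aestronglyMeasurable (by fun_prop))]
  simp_rw [e]
  have h : Tendsto (fun k => ∫ y, g (x - t k * y) ∂η) atTop (𝓝 (∫ _y, g x ∂η)) := by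
    refine tendsto_integral_of_dominated_convergence (fun _ => B)
      (fun k => Continuous.aestronglyMeasurable (by fun_prop)) (integrable_const B)
      (fun k => ae_of_all _ fun y => hB _) (ae_of_all _ fun y => ?_)
    have : Tendsto (fun k => x - t k * y) atTop (𝓝 x) := by
      simpa using (ht.mul_const y).const_sub x
    exact (hg.tendsto x).comp this
  simpa using h

/-- The maximal inequality implies almost everywhere convergence, as convergence holds
everywhere for functions of a dense class. -/
theorem ae_tendsto_measConv {t : ℕ → ℝ} (ht : Tendsto t atTop (𝓝 0)) (η : Measure ℝ)
    [IsProbabilityMeasure η] {C : ℝ≥0} (hC : ∀ f : ℝ → ℂ, MemLp f 2 volume →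
      eLpNorm (fun x => ⨆ k, ‖measConv (contraction (t k) η) f x‖ₑ) 2 volume
        ≤ C * eLpNorm f 2 volume) {f : ℝ → ℂ} (hf : MemLp f 2 volume) :
    ∀ᵐ x, Tendsto (fun k => measConv (contraction (t k) η) f x) atTop (𝓝 (f x)) := by
  have := fun k => isProbabilityMeasure_contraction (t k) η
  -- the oscillation of the sequence around its supposed limit
  set O : ℝ → ℝ≥0∞ := fun x =>
    limsup (fun k => ‖measConv (contraction (t k) η) f x - f x‖ₑ) atTop with hO
  have hOm : AEMeasurable O := by
    simp only [hO, limsup_eq_iInf_iSup_of_nat]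
    exact AEMeasurable.iInf fun N => AEMeasurable.iSup fun k => AEMeasurable.iSup fun _ =>
      ((aestronglyMeasurable_measConv _ hf.1).sub hf.1).enorm
  have hbound : ∀ ε : ℝ≥0∞, ε ≠ 0 → eLpNorm O 2 volume ≤ (C + 1) * ε := by
    intro ε hε
    obtain ⟨g, hgc, hfg, hg, hgL⟩ := hf.exists_hasCompactSupport_eLpNorm_sub_le (by norm_num) hε
    have hh := hf.sub hgL
    have hpt : ∀ᵐ x, O x ≤ (⨆ k, ‖measConv (contraction (t k) η) (f - g) x‖ₑ) +
        ‖(f - g) x‖ₑ := by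
      have hadd : ∀ᵐ x, ∀ k, measConv (contraction (t k) η) ((f - g) + g) x =
          measConv (contraction (t k) η) (f - g) x + measConv (contraction (t k) η) g x :=
        ae_all_iff.2 fun k => measConv_add _ hh hgL
      filter_upwards [hadd] with x hx
      rw [sub_add_cancel] at hx
      have hlim : Tendsto (fun k => (⨆ k, ‖measConv (contraction (t k) η) (f - g) x‖ₑ) +
          ‖(f - g) x‖ₑ + ‖measConv (contraction (t k) η) g x - g x‖ₑ) atTop
          (𝓝 ((⨆ k, ‖measConv (contraction (t k) η) (f - g) x‖ₑ) + ‖(f - g) x‖ₑ + 0)) := by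
        refine Tendsto.const_add _ ?_
        have h0 := ((tendsto_measConv_contraction ht η hg hgc x).sub_const (g x)).enorm
        simpa using h0
      rw [add_zero] at hlim
      rw [hO, ← hlim.limsup_eq]
      refine limsup_le_limsup (Eventually.of_forall fun k => ?_)
      have e : measConv (contraction (t k) η) f x - f x =
          measConv (contraction (t k) η) (f - g) x - (f - g) x +
            (measConv (contraction (t k) η) g x - g x) := by
        rw [hx k, Pi.sub_apply]
        ring
      simp only [e]
      refine (enorm_add_le _ _).trans (add_le_add_left ((enorm_sub_le).trans ?_) _)
      gcongr
      exact le_iSup (fun k => ‖measConv (contraction (t k) η) (f - g) x‖ₑ) k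
    have hsm : AEMeasurable fun x => ⨆ k, ‖measConv (contraction (t k) η) (f - g) x‖ₑ :=
      AEMeasurable.iSup fun k => (aestronglyMeasurable_measConv _ hh.1).enorm
    calc eLpNorm O 2 volume
        ≤ eLpNorm ((fun x => ⨆ k, ‖measConv (contraction (t k) η) (f - g) x‖ₑ) +
            fun x => ‖(f - g) x‖ₑ) 2 volume := by
          refine eLpNorm_mono_enorm_ae ?_
          filter_upwards [hpt] with x hx
          simpa only [enorm_eq_self, Pi.add_apply] using hx
      _ ≤ eLpNorm (fun x => ⨆ k, ‖measConv (contraction (t k) η) (f - g) x‖ₑ) 2 volume +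
            eLpNorm (fun x => ‖(f - g) x‖ₑ) 2 volume :=
          eLpNorm_add_le hsm.aestronglyMeasurable hh.1.enorm.aestronglyMeasurable (by norm_num)
      _ ≤ C * eLpNorm (f - g) 2 volume + eLpNorm (f - g) 2 volume := by
          refine add_le_add (hC _ hh) (le_of_eq ?_)
          exact eLpNorm_enorm _
      _ = (C + 1) * eLpNorm (f - g) 2 volume := by ring
      _ ≤ _ := by gcongr
  have hO0 : eLpNorm O 2 volume = 0 := by
    have hlim : Tendsto (fun N : ℕ => ((C : ℝ≥0∞) + 1) * (N : ℝ≥0∞)⁻¹) atTop (𝓝 ((C + 1) * 0)) :=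
      ENNReal.Tendsto.const_mul ENNReal.tendsto_inv_nat_nhds_zero (Or.inr (by finiteness))
    rw [mul_zero] at hlim
    exact le_antisymm (ge_of_tendsto' hlim fun N => hbound _ (by simp)) zero_le
  rw [eLpNorm_eq_zero_iff hOm.aestronglyMeasurable (by norm_num)] at hO0
  filter_upwards [hO0] with x hx
  rw [tendsto_iff_edist_tendsto_0]
  simp_rw [edist_eq_enorm_sub]
  refine tendsto_of_le_liminf_of_limsup_le zero_le ?_
  exact hx.le

theorem mainTheorem9 :
    SeparatedClouds (fun m => 2 ^ 2 ^ (2 * (m + 1)))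
      (fun k => 1 / (2 : ℝ) ^ 2 ^ (2 * (k + 1) + 1)) ∧
    ∀ (n : ℕ → ℕ) (t : ℕ → ℝ), SeparatedClouds n t →
      Tendsto (rieszPartialMeasure n) atTop (𝓝 (rieszMeasure n)) ∧
      IsProbabilityMeasure (nuMeasure n) ∧
      (∀ f : ℝ → ℂ, MemLp f 2 volume →
        ∀ᵐ x ∂(volume : Measure ℝ), ∀ k,
          Integrable (fun y => f (x - y)) (contraction (t k) (nuMeasure n))) ∧
      (∃ C : ℝ≥0, ∀ f : ℝ → ℂ, MemLp f 2 volume →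
        eLpNorm (fun x => ⨆ k, ‖measConv (contraction (t k) (nuMeasure n)) f x‖ₑ) 2 volume
          ≤ C * eLpNorm f 2 volume) ∧
      (∀ f : ℝ → ℂ, MemLp f 2 volume →
        ∀ᵐ x ∂(volume : Measure ℝ),
          Tendsto (fun k => measConv (contraction (t k) (nuMeasure n)) f x) atTop (𝓝 (f x))) := by
  refine ⟨separatedClouds_two_pow, fun n t hs => ?_⟩
  have hprob := isProbabilityMeasure_nuMeasure hs.freq_pos hs.growth
  have := fun k => isProbabilityMeasure_contraction (t k) (nuMeasure n)
  refine ⟨tendsto_rieszPartialMeasure hs.freq_pos hs.growth, hprob, fun f hf =>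
    ae_all_iff.2 fun k => ae_integrable_comp_sub _ hf, exists_eLpNorm_iSup_le hs, fun f hf => ?_⟩
  obtain ⟨C, hC⟩ := exists_eLpNorm_iSup_le hs
  exact ae_tendsto_measConv hs.tendsto_zero (nuMeasure n) hC hf
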